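/- Let $L^2_a(\mathbb D)$ be the Bergman space of the unit disk, with normalized area measure $dA/\pi$ and orthonormal basis $e_n(z)=\sqrt{n+1}\,z^n$ ($n\ge 0$). Let $P$ be the orthogonal projection of $L^2(\mathbb D)$ onto $L^2_a(\mathbb D)$, and let $K$ be the unitary operator from $L^2_a(\mathbb D)$ onto the harmonic Bergman space with $K e_{2n}=e_n$ and $K e_{2n+1}=\overline{e_{n+1}}$ for all $n\ge 0$. For $\varphi\in L^\infty(\mathbb D)$ the H-Toeplitz operator with symbol $\varphi$ is $B_\varphi f=P(\varphi\cdot Kf)$ on $L^2_a(\mathbb D)$. A bounded operator $T$ is hyponormal if $T^*T-TT^*\ge 0$, co-hyponormal if $T^*$ is hyponormal, and $k$-hyponormal if the $(k+1)\times(k+1)$ operator matrix $(T^{*j}T^{i})_{0\le i,j\le k}$ is positive semidefinite. **Theorem.** Let $t>s\ge 0$ be integers, $\delta=t-s$, and $B=B_{z^t\bar z^s}$. Let $\mathcal F$ be the set of integers $j\ge 2\delta+1$ that are not of the form $2(m-\delta)$ with an integer $m\ge 2\delta+1$. For $j\in\mathcal F$ let $W_1(s,\delta,j)\circ W_2(s,\delta,j)$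 be the unilateral weighted shift on $\ell^2$ with weights $$\sqrt{\frac{2^n+\frac{2\delta+1}{j-2\delta}}{2^n+\frac{2\delta+s+1}{j-2\delta}}}\cdot\sqrt{\frac{2^n+\frac{\delta+1}{j-2\delta}}{2^n+\frac{2\delta+s+1}{j-2\delta}}},\qquad n=0,1,2,\dots$$ 1. $B^*$ has the orthogonal direct sum decomposition $$B^*=M\oplus D_1\oplus\Bigl(\bigoplus_{j\in\mathcal F}W_1(s,\delta,j)\circ W_2(s,\delta,j)\Bigr),$$ where $M$ is an operator on $\mathbb C^{2\delta}$ and $D_1$ is a normal operator on $\mathbb C$. Here $\mathbb C^{2\delta}$ is identified with the span of $e_0,\dots,e_{2\delta-1}$, $\mathbb C$ with the span of $e_{2\delta}$, and the copy of $\ell^2$ with index $j$ with the closed span of the vectors $e_{2^n(j-2\delta)+2\delta}$, $n\ge 0$, in this order. 2. $M$ is normal if $\delta=1$, and is neither hyponormal nor co-hyponormal if $\delta>1$. 3. Each of the shifts $W_1(s,\delta,j)\circ W_2(s,\delta,j)$, $j\in\mathcal F$, is $1$-hyponormal. For every integer $k\ge 1$ with $s\ge\min\{2^{k-1}(2\delta+1),\,2^{k-2}(2\delta-1)+2^{k-1}-1\}$,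 each of them is $k$-hyponormal. 4. If $\delta=1$, then $B^*$ is hyponormal and $B$ is not hyponormal. If $\delta>1$, then neither $B^*$ nor $B$ is hyponormal. 5. $B^*$ and $B$ are contractive. -/

import Mathlib

open MeasureTheory Filter Topology
open scoped ENNReal ComplexConjugate InnerProductSpace

noncomputable section

namespace HToeplitz

/-! ### The normalized area measure on the unit disk -/

/-- Normalized area measure `dA / π` on the open unit disk, as a measure on `ℂ`. -/
def diskMeasure : Measure ℂ :=
  (ENNReal.ofReal Real.pi)⁻¹ • (volume.restrict (Metric.ball (0 : ℂ) 1))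

instance : IsProbabilityMeasure diskMeasure where
  measure_univ := by
    have h : ENNReal.ofReal Real.pi = (NNReal.pi : ℝ≥0∞) := by
      rw [← NNReal.coe_real_pi, ENNReal.ofReal_coe_nnreal]
    simp only [diskMeasure, Measure.smul_apply, Measure.restrict_apply MeasurableSet.univ,
      Set.univ_inter, Complex.volume_ball, smul_eq_mul, h]
    simp [ENNReal.inv_mul_cancel, NNReal.pi_ne_zero]

theorem integral_diskMeasure (f : ℂ → ℂ) :
    ∫ z, f z ∂diskMeasure = (Real.pi : ℂ)⁻¹ * ∫ z in Metric.ball (0 : ℂ) 1, f z := by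
  rw [diskMeasure, integral_smul_measure, ENNReal.toReal_inv, ENNReal.toReal_ofReal Real.pi_pos.le,
    Complex.real_smul, Complex.ofReal_inv]

theorem ae_diskMeasure_mem_ball : ∀ᵐ z ∂diskMeasure, z ∈ Metric.ball (0 : ℂ) 1 :=
  Measure.ae_smul_measure (ae_restrict_mem Metric.isOpen_ball.measurableSet) _

/-- Integration over a disk in polar coordinates. -/
theorem integral_ball_eq_circleAverage {f : ℂ → ℂ} {c : ℂ} {r : ℝ}
    (hf : ContinuousOn f (Metric.closedBall c r)) :
    ∫ z in Metric.ball c r, f z =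
      ∫ ρ in Set.Ioo (0 : ℝ) r, (ρ * (2 * Real.pi)) • Real.circleAverage f c ρ := by
  have h1 : ∫ z in Metric.ball c r, f z =
      ∫ w, (Metric.ball (0 : ℂ) r).indicator (fun w => f (c + w)) w := by
    rw [← integral_indicator Metric.isOpen_ball.measurableSet, ← integral_add_left_eq_self _ c]
    congr 1
    ext w
    simp [Set.indicator, Metric.mem_ball, dist_eq_norm]
  have hsub : Set.Ioo (0 : ℝ) r ×ˢ Set.Ioo (-Real.pi) Real.pi ⊆ polarCoord.target := by
    rintro ⟨a, b⟩ h
    exact ⟨h.1.1, h.2⟩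
  have h2 : ∫ w, (Metric.ball (0 : ℂ) r).indicator (fun w => f (c + w)) w =
      ∫ p in Set.Ioo (0 : ℝ) r ×ˢ Set.Ioo (-Real.pi) Real.pi,
        p.1 • f (circleMap c p.1 p.2) := by
    rw [← Complex.integral_comp_polarCoord_symm]
    have : polarCoord.target ∩ (Set.Ioo (0 : ℝ) r ×ˢ Set.Ioo (-Real.pi) Real.pi) =
        Set.Ioo (0 : ℝ) r ×ˢ Set.Ioo (-Real.pi) Real.pi := Set.inter_eq_right.2 hsub
    rw [← this, ← setIntegral_indicator (measurableSet_Ioo.prod measurableSet_Ioo)]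
    refine setIntegral_congr_fun polarCoord.open_target.measurableSet ?_
    rintro ⟨a, b⟩ ⟨ha, hb⟩
    have hn : ‖(Complex.polarCoord.symm (a, b) : ℂ)‖ = a := by
      simpa using abs_of_pos (show (0 : ℝ) < a from ha)
    have he : c + (Complex.polarCoord.symm (a, b) : ℂ) = circleMap c a b := by
      simp [circleMap, Complex.polarCoord_symm_apply, Complex.exp_mul_I]
    simp only
    by_cases har : a < r
    · rw [Set.indicator_of_mem (by rwa [mem_ball_zero_iff, hn]),
        Set.indicator_of_mem (show (a, b) ∈ Set.Ioo (0 : ℝ) r ×ˢ Set.Ioo (-Real.pi) Real.pi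
          from ⟨⟨ha, har⟩, hb⟩), he]
    · rw [Set.indicator_of_notMem (by rwa [mem_ball_zero_iff, hn]),
        Set.indicator_of_notMem (fun h : (a, b) ∈ Set.Ioo (0 : ℝ) r ×ˢ Set.Ioo (-Real.pi) Real.pi =>
          har h.1.2), smul_zero]
  have hcont : ContinuousOn (fun p : ℝ × ℝ => p.1 • f (circleMap c p.1 p.2))
      (Set.Icc (0 : ℝ) r ×ˢ Set.Icc (-Real.pi) Real.pi) := by
    refine continuousOn_fst.smul (hf.comp ?_ ?_)
    · unfold circleMap
      fun_prop
    · rintro ⟨a, b⟩ ⟨ha, -⟩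
      simp [circleMap, abs_of_nonneg ha.1, ha.2]
  rw [h1, h2, Measure.volume_eq_prod, setIntegral_prod]
  · refine setIntegral_congr_fun measurableSet_Ioo fun ρ _ => ?_
    simp only
    rw [integral_smul, Real.circleAverage_def, mul_smul, smul_inv_smul₀ (by positivity),
      ← integral_Ioc_eq_integral_Ioo, ← intervalIntegral.integral_of_le
        (by linarith [Real.pi_pos])]
    congr 1
    have := ((periodic_circleMap c ρ).comp f).intervalIntegral_add_eq (-Real.pi) 0
    simp only [Function.comp_apply] at this
    convert this using 2 <;> ring
  · exact (hcont.integrableOn_compact (isCompact_Icc.prod isCompact_Icc)).mono_set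
      (Set.prod_mono Set.Ioo_subset_Icc_self Set.Ioo_subset_Icc_self)

/-! ### The Bergman space -/

/-- The Bergman space `L²_a(𝔻)`: the classes in `L²(𝔻)` that have an analytic representative. -/
def bergman : Submodule ℂ (Lp ℂ 2 diskMeasure) where
  carrier := {f | ∃ F : ℂ → ℂ, DifferentiableOn ℂ F (Metric.ball (0 : ℂ) 1) ∧ f =ᵐ[diskMeasure] F}
  add_mem' := by
    rintro f g ⟨F, hF, hf⟩ ⟨G, hG, hg⟩
    exact ⟨F + G, hF.add hG, (Lp.coeFn_add f g).trans (hf.add hg)⟩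
  zero_mem' := ⟨0, differentiableOn_const 0, Lp.coeFn_zero ℂ 2 diskMeasure⟩
  smul_mem' := by
    rintro a f ⟨F, hF, hf⟩
    exact ⟨a • F, hF.const_smul a, (Lp.coeFn_smul a f).trans (hf.const_smul a)⟩

/-- Point evaluations are bounded on the Bergman space. -/
theorem norm_le_of_ae_eq {f : Lp ℂ 2 diskMeasure} {F : ℂ → ℂ}
    (hF : DifferentiableOn ℂ F (Metric.ball (0 : ℂ) 1)) (hf : f =ᵐ[diskMeasure] F)
    {z : ℂ} {r : ℝ} (hr : 0 < r) (hz : ‖z‖ + r < 1) :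
    ‖F z‖ ≤ (r ^ 2)⁻¹ * ‖f‖ := by
  have hsub : Metric.closedBall z r ⊆ Metric.ball (0 : ℂ) 1 := by
    intro w hw
    rw [mem_ball_zero_iff]
    have h1 : ‖w - z‖ ≤ r := by simpa [dist_eq_norm] using hw
    have h2 := norm_add_le (w - z) z
    simp only [sub_add_cancel] at h2
    linarith
  have hmean : ∫ w in Metric.ball z r, F w = (Real.pi * r ^ 2 : ℝ) • F z := by
    rw [integral_ball_eq_circleAverage (hF.continuousOn.mono hsub)]
    have : ∀ ρ ∈ Set.Ioo (0 : ℝ) r,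
        (ρ * (2 * Real.pi)) • Real.circleAverage F z ρ = (ρ * (2 * Real.pi)) • F z := by
      intro ρ hρ
      rw [DiffContOnCl.circleAverage]
      rw [abs_of_pos hρ.1]
      refine (hF.mono ?_).diffContOnCl_ball subset_rfl
      exact (Metric.closedBall_subset_closedBall hρ.2.le).trans hsub
    rw [setIntegral_congr_fun measurableSet_Ioo this, integral_smul_const,
      ← integral_Ioc_eq_integral_Ioo, ← intervalIntegral.integral_of_le hr.le,
      intervalIntegral.integral_mul_const, integral_id]
    congr 1
    ring
  have hint : Integrable F diskMeasure :=
    ((Lp.memLp f).integrable (by norm_num)).congr hf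
  have hint' : IntegrableOn F (Metric.ball (0 : ℂ) 1) := by
    have := hint
    rw [diskMeasure, integrable_smul_measure (by simp) (by simp [Real.pi_pos])] at this
    exact this
  have hL1 : ∫ w in Metric.ball (0 : ℂ) 1, ‖F w‖ ≤ Real.pi * ‖f‖ := by
    have h1 : ∫ w, ‖F w‖ ∂diskMeasure = Real.pi⁻¹ * ∫ w in Metric.ball (0 : ℂ) 1, ‖F w‖ := by
      rw [diskMeasure, integral_smul_measure, ENNReal.toReal_inv,
        ENNReal.toReal_ofReal Real.pi_pos.le, smul_eq_mul]
    have h2 : ∫ w, ‖F w‖ ∂diskMeasure ≤ ‖f‖ := by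
      rw [integral_norm_eq_lintegral_enorm hint.1, ← eLpNorm_one_eq_lintegral_enorm,
        ← eLpNorm_congr_ae hf, Lp.norm_def]
      exact ENNReal.toReal_mono (Lp.eLpNorm_ne_top f)
        (eLpNorm_le_eLpNorm_of_exponent_le (by norm_num) (Lp.aestronglyMeasurable f))
    rw [h1] at h2
    rwa [inv_mul_le_iff₀ Real.pi_pos] at h2
  have h3 : ‖∫ w in Metric.ball z r, F w‖ ≤ Real.pi * ‖f‖ := by
    refine (norm_integral_le_integral_norm _).trans (le_trans ?_ hL1)
    exact setIntegral_mono_set hint'.norm (ae_of_all _ fun _ => norm_nonneg _)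
      (Metric.ball_subset_closedBall.trans hsub).eventuallyLE
  rw [hmean, norm_smul, Real.norm_of_nonneg (by positivity), mul_assoc] at h3
  have h4 := le_of_mul_le_mul_left h3 Real.pi_pos
  rwa [inv_mul_eq_div, le_div_iff₀ (by positivity), mul_comm]

theorem isClosed_bergman : IsClosed (bergman : Set (Lp ℂ 2 diskMeasure)) := by
  refine IsSeqClosed.isClosed ?_
  intro u f hu huf
  choose F hF hFu using hu
  have hbound : ∀ (m n : ℕ) (z : ℂ) (r : ℝ), 0 < r → ‖z‖ + r < 1 →
      ‖F m z - F n z‖ ≤ (r ^ 2)⁻¹ * ‖u m - u n‖ := by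
    intro m n z r hr hz
    exact norm_le_of_ae_eq (F := F m - F n) ((hF m).sub (hF n))
      ((Lp.coeFn_sub (u m) (u n)).trans ((hFu m).sub (hFu n))) hr hz
  have hcau : CauchySeq u := huf.cauchySeq
  have hUC : ∀ x ∈ Metric.ball (0 : ℂ) 1, ∃ t ∈ 𝓝[Metric.ball (0 : ℂ) 1] x, x ∈ t ∧
      UniformCauchySeqOn F atTop t := by
    intro x hx
    rw [mem_ball_zero_iff] at hx
    set r := (1 - ‖x‖) / 3 with hr
    have hr0 : 0 < r := by rw [hr]; linarith
    refine ⟨Metric.ball x r, mem_nhdsWithin_of_mem_nhds (Metric.ball_mem_nhds x hr0),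
      Metric.mem_ball_self hr0, ?_⟩
    rw [Metric.uniformCauchySeqOn_iff]
    intro ε hε
    obtain ⟨N, hN⟩ := Metric.cauchySeq_iff.1 hcau (r ^ 2 * ε) (by positivity)
    refine ⟨N, fun m hm n hn y hy => ?_⟩
    have hy' : ‖y‖ + r < 1 := by
      have h1 : ‖y - x‖ < r := by simpa [dist_eq_norm] using hy
      have h2 := norm_add_le (y - x) x
      simp only [sub_add_cancel] at h2
      linarith
    have h3 := hN m hm n hn
    rw [dist_eq_norm] at h3 ⊢
    refine (hbound m n y r hr0 hy').trans_lt ?_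
    rwa [inv_mul_lt_iff₀ (by positivity)]
  have hlim : ∀ x ∈ Metric.ball (0 : ℂ) 1, ∃ a, Tendsto (fun n => F n x) atTop (𝓝 a) := by
    intro x hx
    obtain ⟨t, -, hxt, ht⟩ := hUC x hx
    exact cauchySeq_tendsto_of_complete (ht.cauchySeq hxt)
  choose! G hG using hlim
  have hloc : TendstoLocallyUniformlyOn F G atTop (Metric.ball (0 : ℂ) 1) := by
    refine tendstoLocallyUniformlyOn_of_forall_exists_nhds fun x hx => ?_
    obtain ⟨t, ht, -, htc⟩ := hUC x hx
    refine ⟨t ∩ Metric.ball (0 : ℂ) 1, inter_mem ht self_mem_nhdsWithin, ?_⟩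
    exact (htc.mono Set.inter_subset_left).tendstoUniformlyOn_of_tendsto fun y hy => hG y hy.2
  refine ⟨G, hloc.differentiableOn (Eventually.of_forall hF) Metric.isOpen_ball, ?_⟩
  obtain ⟨ns, hns, hae⟩ := (tendstoInMeasure_of_tendsto_Lp huf).exists_seq_tendsto_ae
  filter_upwards [hae, ae_diskMeasure_mem_ball, ae_all_iff.2 hFu] with x hx hxb hxF
  refine tendsto_nhds_unique hx ?_
  simp only [hxF]
  exact (hG x hxb).comp hns.tendsto_atTop

instance : CompleteSpace bergman := isClosed_bergman.completeSpace_coe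

/-! ### Monomials and the bases -/

theorem memLp_monomial (r : ℝ≥0∞) (p q : ℕ) :
    MemLp (fun z : ℂ => z ^ p * conj z ^ q) r diskMeasure := by
  refine MemLp.of_bound (Continuous.aestronglyMeasurable (by fun_prop)) 1 ?_
  filter_upwards [ae_diskMeasure_mem_ball] with z hz
  rw [mem_ball_zero_iff] at hz
  simp only [norm_mul, norm_pow, RCLike.norm_conj]
  exact mul_le_one₀ (pow_le_one₀ (norm_nonneg _) hz.le) (by positivity)
    (pow_le_one₀ (norm_nonneg _) hz.le)

/-- The function `z ^ p * (conj z) ^ q`, as an element of `Lʳ(𝔻)`. -/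
def monomial (r : ℝ≥0∞) (p q : ℕ) : Lp ℂ r diskMeasure :=
  (memLp_monomial r p q).toLp _

theorem integral_monomial (p q : ℕ) :
    ∫ z, z ^ p * conj z ^ q ∂diskMeasure = if p = q then ((p : ℂ) + 1)⁻¹ else 0 := by
  have key : ∀ (m q : ℕ) (ρ : ℝ), 0 < ρ →
      Real.circleAverage (fun z : ℂ => z ^ (m + q) * conj z ^ q) 0 ρ =
        (ρ : ℂ) ^ (2 * q) * (0 : ℂ) ^ m := by
    intro m q ρ hρ
    have h1 : Real.circleAverage (fun z : ℂ => z ^ (m + q) * conj z ^ q) 0 ρ =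
        Real.circleAverage (fun z : ℂ => (ρ : ℂ) ^ (2 * q) * z ^ m) 0 ρ := by
      refine Real.circleAverage_congr_sphere fun z hz => ?_
      have hz' : ‖z‖ = ρ := by simpa [abs_of_pos hρ] using hz
      have h2 : z * conj z = (ρ : ℂ) ^ 2 := by
        rw [Complex.mul_conj, Complex.normSq_eq_norm_sq, hz']; push_cast; rfl
      change z ^ (m + q) * conj z ^ q = (ρ : ℂ) ^ (2 * q) * z ^ m
      rw [pow_add, mul_assoc, ← mul_pow, h2, pow_mul, mul_comm]
    rw [h1, DiffContOnCl.circleAverage]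
    exact Differentiable.diffContOnCl (by fun_prop)
  have hle : ∀ m q : ℕ, ∫ z, z ^ (m + q) * conj z ^ q ∂diskMeasure =
      if m = 0 then ((q : ℂ) + 1)⁻¹ else 0 := by
    intro m q
    rw [integral_diskMeasure, integral_ball_eq_circleAverage (by fun_prop)]
    have h2 : ∀ ρ ∈ Set.Ioo (0 : ℝ) 1, (ρ * (2 * Real.pi)) •
        Real.circleAverage (fun z : ℂ => z ^ (m + q) * conj z ^ q) 0 ρ =
        ((ρ ^ (2 * q + 1) : ℝ) : ℂ) * (2 * Real.pi * (0 : ℂ) ^ m) := by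
      intro ρ hρ
      rw [key m q ρ hρ.1, Complex.real_smul]
      push_cast
      ring
    rw [setIntegral_congr_fun measurableSet_Ioo h2, integral_mul_const, integral_complex_ofReal,
      ← integral_Ioc_eq_integral_Ioo, ← intervalIntegral.integral_of_le zero_le_one, integral_pow]
    have hpi : (Real.pi : ℂ) ≠ 0 := by exact_mod_cast Real.pi_ne_zero
    have hq : (q : ℂ) + 1 ≠ 0 := by exact_mod_cast q.succ_ne_zero
    have hq2 : (2 * q + 1 + 1 : ℂ) = 2 * (q + 1) := by ring
    rcases Nat.eq_zero_or_pos m with rfl | hm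
    · simp only [pow_zero, if_true, one_pow]
      push_cast
      rw [hq2]
      field_simp
      simp
    · simp [hm.ne']
  rcases le_total q p with h | h
  · obtain ⟨m, rfl⟩ := Nat.exists_eq_add_of_le' h
    rw [hle]
    rcases Nat.eq_zero_or_pos m with rfl | hm
    · simp
    · simp [hm.ne']
  · obtain ⟨m, rfl⟩ := Nat.exists_eq_add_of_le' h
    have h3 : ∫ z, z ^ p * conj z ^ (m + p) ∂diskMeasure =
        conj (∫ z, z ^ (m + p) * conj z ^ p ∂diskMeasure) := by
      rw [← integral_conj]
      congr 1
      ext z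
      simp [mul_comm]
    rw [h3, hle]
    rcases Nat.eq_zero_or_pos m with rfl | hm
    · simp
    · simp [hm.ne']

theorem inner_monomial (p q p' q' : ℕ) :
    ⟪monomial 2 p q, monomial 2 p' q'⟫_ℂ =
      if p' + q = q' + p then ((p' : ℂ) + q + 1)⁻¹ else 0 := by
  rw [L2.inner_def]
  have h : (fun z => ⟪monomial 2 p q z, monomial 2 p' q' z⟫_ℂ) =ᵐ[diskMeasure]
      fun z => z ^ (p' + q) * conj z ^ (q' + p) := by
    filter_upwards [(memLp_monomial 2 p q).coeFn_toLp, (memLp_monomial 2 p' q').coeFn_toLp]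
      with z h1 h2
    rw [monomial, monomial, h1, h2, RCLike.inner_apply]
    simp only [map_mul, map_pow, Complex.conj_conj]
    ring
  rw [integral_congr_ae h, integral_monomial]
  push_cast
  rfl

theorem monomial_mem_bergman (n : ℕ) : monomial 2 n 0 ∈ bergman :=
  ⟨fun z => z ^ n, by fun_prop, by
    filter_upwards [(memLp_monomial 2 n 0).coeFn_toLp] with z hz
    rw [monomial, hz]; simp⟩

/-- The orthonormal basis `e_n(z) = √(n+1) zⁿ` of the Bergman space. -/
def basisVec (n : ℕ) : bergman :=
  ((√((n : ℝ) + 1) : ℝ) : ℂ) • ⟨monomial 2 n 0, monomial_mem_bergman n⟩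

/-- The orthonormal basis of the harmonic Bergman space, enumerated as
`e_0, conj e_1, e_1, conj e_2, e_2, …`: the even entry `2n` is `e_n(z) = √(n+1) zⁿ` and the odd
entry `2n+1` is `conj (e_{n+1}(z)) = √(n+2) (conj z)^(n+1)`. -/
def harmonicVec (n : ℕ) : Lp ℂ 2 diskMeasure :=
  if Even n then ((√(((n / 2 : ℕ) : ℝ) + 1) : ℝ) : ℂ) • monomial 2 (n / 2) 0
  else ((√(((n / 2 : ℕ) : ℝ) + 2) : ℝ) : ℂ) • monomial 2 0 (n / 2 + 1)

theorem ofReal_sqrt_mul_self {x : ℝ} (hx : 0 ≤ x) : ((√x : ℝ) : ℂ) * ((√x : ℝ) : ℂ) = (x : ℂ) := by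
  rw [← Complex.ofReal_mul, Real.mul_self_sqrt hx]

theorem orthonormal_basisVec : Orthonormal ℂ basisVec := by
  rw [orthonormal_iff_ite]
  intro i j
  simp only [basisVec, Submodule.coe_inner, Submodule.coe_smul, inner_smul_left, inner_smul_right,
    inner_monomial, Complex.conj_ofReal]
  by_cases h : i = j
  · subst h
    have hi : (i : ℂ) + 1 ≠ 0 := by exact_mod_cast i.succ_ne_zero
    have := ofReal_sqrt_mul_self (show (0 : ℝ) ≤ (i : ℝ) + 1 by positivity)
    push_cast at this
    simp only [add_zero, zero_add, if_true, Nat.cast_zero]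
    rw [← mul_assoc, this, mul_inv_cancel₀ hi]
  · rw [if_neg (by omega), if_neg h]
    simp

theorem orthonormal_harmonicVec : Orthonormal ℂ harmonicVec := by
  rw [orthonormal_iff_ite]
  intro i j
  have hi1 : ((i / 2 : ℕ) : ℂ) + 1 ≠ 0 := by exact_mod_cast (i / 2).succ_ne_zero
  have hi2 : ((i / 2 : ℕ) : ℂ) + 2 ≠ 0 := by exact_mod_cast (i / 2 + 1).succ_ne_zero
  have hs1 := ofReal_sqrt_mul_self (show (0 : ℝ) ≤ ((i / 2 : ℕ) : ℝ) + 1 by positivity)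
  have hs2 := ofReal_sqrt_mul_self (show (0 : ℝ) ≤ ((i / 2 : ℕ) : ℝ) + 2 by positivity)
  push_cast at hs1 hs2
  by_cases hi : Even i <;> by_cases hj : Even j <;>
    simp only [harmonicVec, hi, hj, if_true, if_false, inner_smul_left, inner_smul_right,
      inner_monomial, Complex.conj_ofReal]
  · by_cases h : i = j
    · subst h
      simp only [add_zero, zero_add, if_true, Nat.cast_zero]
      rw [← mul_assoc, hs1, mul_inv_cancel₀ hi1]
    · rw [if_neg (by grind), if_neg h]; simp
  · rw [if_neg (by omega), if_neg (by grind)]; simp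
  · rw [if_neg (by omega), if_neg (by grind)]; simp
  · by_cases h : i = j
    · subst h
      simp only [zero_add, add_zero, if_true, Nat.cast_zero]
      rw [← mul_assoc, hs2]
      push_cast
      rw [add_assoc, one_add_one_eq_two, mul_inv_cancel₀ hi2]
    · rw [if_neg (by grind), if_neg h]; simp

/-! ### The operator `K` and H-Toeplitz operators -/

/-- The isometry `ℓ² → H` that sends the canonical basis to a given orthonormal sequence. -/
def synthesis {H : Type*} [NormedAddCommGroup H] [InnerProductSpace ℂ H] [CompleteSpace H]
    {v : ℕ → H} (hv : Orthonormal ℂ v) : lp (fun _ : ℕ => ℂ) 2 →ₗᵢ[ℂ] H :=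
  hv.orthogonalFamily.linearIsometry

theorem synthesis_single {H : Type*} [NormedAddCommGroup H] [InnerProductSpace ℂ H]
    [CompleteSpace H] {v : ℕ → H} (hv : Orthonormal ℂ v) (n : ℕ) :
    synthesis hv (lp.single 2 n 1) = v n := by
  simp [synthesis, OrthogonalFamily.linearIsometry_apply_single]

/-- The operator `K` with `K e_{2n} = e_n` and `K e_{2n+1} = conj e_{n+1}`, that is
`K f = ∑ₙ ⟨f, e_n⟩ h_n` for the enumerated basis `h_n` of the harmonic Bergman space. Its values lie
in the harmonic Bergman space, which is regarded here as a subspace of `L²(𝔻)`. -/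
def K : bergman →L[ℂ] Lp ℂ 2 diskMeasure :=
  (synthesis orthonormal_harmonicVec).toContinuousLinearMap ∘L
    ContinuousLinearMap.adjoint (synthesis orthonormal_basisVec).toContinuousLinearMap

theorem K_basisVec (n : ℕ) : K (basisVec n) = harmonicVec n := by
  have h : ContinuousLinearMap.adjoint (synthesis orthonormal_basisVec).toContinuousLinearMap
      (basisVec n) = lp.single 2 n 1 := by
    rw [← synthesis_single orthonormal_basisVec n]
    refine ext_inner_right ℂ fun x => ?_
    rw [ContinuousLinearMap.adjoint_inner_left]
    exact (synthesis orthonormal_basisVec).inner_map_map _ _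
  rw [K, ContinuousLinearMap.comp_apply, h]
  exact synthesis_single orthonormal_harmonicVec n

/-- Multiplication by `φ ∈ L^∞(𝔻)` on `L²(𝔻)`. -/
def mulOp (φ : Lp ℂ ∞ diskMeasure) : Lp ℂ 2 diskMeasure →L[ℂ] Lp ℂ 2 diskMeasure :=
  (ContinuousLinearMap.mul ℂ ℂ).holderL diskMeasure ∞ 2 2 φ

/-- The H-Toeplitz operator `B_φ = P M_φ K` on the Bergman space. -/
def hToeplitz (φ : Lp ℂ ∞ diskMeasure) : bergman →L[ℂ] bergman :=
  bergman.orthogonalProjectionOnto ∘L mulOp φ ∘L K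

/-! ### Hyponormality -/

section Hyponormal

variable {H : Type*} [NormedAddCommGroup H] [InnerProductSpace ℂ H] [CompleteSpace H]

/-- `T` is hyponormal if `T* T - T T* ≥ 0`. -/
def IsHyponormal (T : H →L[ℂ] H) : Prop :=
  (ContinuousLinearMap.adjoint T ∘L T - T ∘L ContinuousLinearMap.adjoint T).IsPositive

/-- `T` is co-hyponormal if its adjoint is hyponormal. -/
def IsCohyponormal (T : H →L[ℂ] H) : Prop :=
  IsHyponormal (ContinuousLinearMap.adjoint T)

/-- `T` is `k`-hyponormal if the `(k+1) × (k+1)` operator matrix whose `(i, j)` entry is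
`(T*)ʲ Tⁱ` is positive semidefinite as an operator on `H ⊕ ⋯ ⊕ H`. -/
def IsKHyponormal (k : ℕ) (T : H →L[ℂ] H) : Prop :=
  ∀ x : Fin (k + 1) → H,
    0 ≤ (∑ i : Fin (k + 1), ∑ j : Fin (k + 1),
      ⟪x i, ((ContinuousLinearMap.adjoint T) ^ (j : ℕ)) ((T ^ (i : ℕ)) (x j))⟫_ℂ).re

end Hyponormal

/-! ### Weighted shifts -/

/-- The sequence `(0, α₀ x₀, α₁ x₁, …)`. -/
def shiftSeq (α : ℕ → ℝ) (x : ℕ → ℂ) : ℕ → ℂ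
  | 0 => 0
  | n + 1 => (α n : ℂ) * x n

theorem tsum_shiftSeq_le {α : ℕ → ℝ} {C : ℝ} (hC : ∀ n, |α n| ≤ C)
    (x : lp (fun _ : ℕ => ℂ) 2) :
    Summable (fun n => ‖shiftSeq α x n‖ ^ 2) ∧
      ∑' n, ‖shiftSeq α x n‖ ^ 2 ≤ (C * ‖x‖) ^ 2 := by
  have hx := (lp.memℓp x).summable (by norm_num)
  have hxn := lp.norm_rpow_eq_tsum (p := 2) (by norm_num) x
  simp only [ENNReal.toReal_ofNat, Real.rpow_ofNat] at hx hxn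
  have hle : ∀ n, ‖shiftSeq α x (n + 1)‖ ^ 2 ≤ C ^ 2 * ‖x n‖ ^ 2 := by
    intro n
    simp only [shiftSeq, norm_mul, mul_pow, Complex.norm_real, Real.norm_eq_abs]
    gcongr
    exact hC n
  have hy1 : Summable (fun n => ‖shiftSeq α x (n + 1)‖ ^ 2) :=
    Summable.of_nonneg_of_le (fun n => by positivity) hle (hx.mul_left (C ^ 2))
  have hy : Summable (fun n => ‖shiftSeq α x n‖ ^ 2) :=
    (summable_nat_add_iff (f := fun n => ‖shiftSeq α x n‖ ^ 2) 1).1 hy1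
  refine ⟨hy, ?_⟩
  have h0 : ‖shiftSeq α x 0‖ ^ 2 = 0 := by simp [shiftSeq]
  rw [mul_pow, hxn, ← tsum_mul_left, hy.tsum_eq_zero_add, h0, zero_add]
  exact hy1.tsum_le_tsum hle (hx.mul_left _)

theorem memlp_shiftSeq {α : ℕ → ℝ} (hα : BddAbove (Set.range fun n => |α n|))
    (x : lp (fun _ : ℕ => ℂ) 2) : Memℓp (shiftSeq α x) 2 := by
  obtain ⟨C, hC⟩ := hα
  refine memℓp_gen ?_
  simpa using (tsum_shiftSeq_le (fun n => hC ⟨n, rfl⟩) x).1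

/-- The unilateral weighted shift on `ℓ²` with bounded weight sequence `α`:
`W e_n = α_n e_{n+1}`. -/
def weightedShift (α : ℕ → ℝ) (hα : BddAbove (Set.range fun n => |α n|)) :
    lp (fun _ : ℕ => ℂ) 2 →L[ℂ] lp (fun _ : ℕ => ℂ) 2 :=
  LinearMap.mkContinuousOfExistsBound
    { toFun := fun x => ⟨shiftSeq α x, memlp_shiftSeq hα x⟩
      map_add' := fun x y => by
        refine lp.ext (funext fun n => ?_)
        change shiftSeq α (x + y) n = shiftSeq α x n + shiftSeq α y n
        cases n <;> simp [shiftSeq, mul_add]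
      map_smul' := fun c x => by
        refine lp.ext (funext fun n => ?_)
        change shiftSeq α (c • x) n = c • shiftSeq α x n
        cases n <;> simp [shiftSeq, mul_left_comm] }
    (by
      obtain ⟨C, hC⟩ := id hα
      have hC' : ∀ n, |α n| ≤ C := fun n => hC ⟨n, rfl⟩
      have hC0 : 0 ≤ C := (abs_nonneg _).trans (hC' 0)
      refine ⟨C, fun x => lp.norm_le_of_tsum_le (by norm_num) (by positivity) ?_⟩
      simpa using (tsum_shiftSeq_le hC' x).2)

theorem weightedShift_apply (α : ℕ → ℝ) (hα : BddAbove (Set.range fun n => |α n|))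
    (x : lp (fun _ : ℕ => ℂ) 2) (n : ℕ) :
    weightedShift α hα x n = shiftSeq α x n := rfl

theorem weightedShift_single (α : ℕ → ℝ) (hα : BddAbove (Set.range fun n => |α n|)) (n : ℕ) :
    weightedShift α hα (lp.single 2 n 1) = (α n : ℂ) • lp.single 2 (n + 1) 1 := by
  refine lp.ext (funext fun m => ?_)
  rw [weightedShift_apply, lp.coeFn_smul, Pi.smul_apply]
  cases m with
  | zero => simp [shiftSeq, lp.single_apply]
  | succ m =>
    by_cases h : m = n
    · subst h; simp [shiftSeq]
    · simp [shiftSeq, lp.single_apply, h]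

/-- The weight sequence `√((pⁿ + N) / (pⁿ + D))` of a geometrically regular weighted shift. -/
def grwsWeight (p N D : ℝ) (n : ℕ) : ℝ := √((p ^ n + N) / (p ^ n + D))

/-- The weights of the shift `W₁(s, δ, j)`. -/
def weight₁ (s δ j : ℕ) : ℕ → ℝ :=
  grwsWeight 2 ((2 * δ + 1) / ((j : ℝ) - 2 * δ)) ((2 * δ + s + 1) / ((j : ℝ) - 2 * δ))

/-- The weights of the shift `W₂(s, δ, j)`. -/
def weight₂ (s δ j : ℕ) : ℕ → ℝ :=
  grwsWeight 2 ((δ + 1) / ((j : ℝ) - 2 * δ)) ((2 * δ + s + 1) / ((j : ℝ) - 2 * δ))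

/-- The founders: the integers `j ≥ 2δ + 1` that are not in the range of the map
`m ↦ 2 (m - δ)` of `{m | m ≥ 2δ + 1}` into itself. -/
def founders (δ : ℕ) : Set ℕ :=
  {j | 2 * δ + 1 ≤ j ∧ ∀ m, 2 * δ + 1 ≤ m → 2 * (m - δ) ≠ j}

theorem grwsWeight_mem_Icc {N D : ℝ} (hN : 0 ≤ N) (hND : N ≤ D) (n : ℕ) :
    0 ≤ grwsWeight 2 N D n ∧ grwsWeight 2 N D n ≤ 1 := by
  refine ⟨Real.sqrt_nonneg _, Real.sqrt_le_one.2 ?_⟩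
  have : (0 : ℝ) < 2 ^ n := by positivity
  rw [div_le_one (by linarith)]
  linarith

theorem bddAbove_schurWeight (s δ : ℕ) (j : founders δ) :
    BddAbove (Set.range fun n => |weight₁ s δ j n * weight₂ s δ j n|) := by
  have hj : (0 : ℝ) < (j : ℕ) - 2 * δ := by
    have := j.2.1
    have : ((2 * δ + 1 : ℕ) : ℝ) ≤ (j : ℕ) := by exact_mod_cast this
    push_cast at this
    linarith
  refine ⟨1, ?_⟩
  rintro _ ⟨n, rfl⟩
  have h1 := grwsWeight_mem_Icc (N := (2 * δ + 1) / ((j : ℕ) - 2 * δ))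
    (D := (2 * δ + s + 1) / ((j : ℕ) - 2 * δ)) (by positivity)
    (by gcongr; linarith [Nat.cast_nonneg (α := ℝ) s]) n
  have h2 := grwsWeight_mem_Icc (N := (δ + 1) / ((j : ℕ) - 2 * δ))
    (D := (2 * δ + s + 1) / ((j : ℕ) - 2 * δ)) (by positivity)
    (by gcongr; linarith [Nat.cast_nonneg (α := ℝ) s, Nat.cast_nonneg (α := ℝ) δ]) n
  simp only [weight₁, weight₂]
  rw [abs_of_nonneg (mul_nonneg h1.1 h2.1)]
  exact mul_le_one₀ h1.2 h2.1 h2.2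

/-- The Schur product `W₁(s, δ, j) ∘ W₂(s, δ, j)`: the weighted shift whose weights are the
products of the weights of the two shifts. -/
def schurShift (s δ : ℕ) (j : founders δ) :
    lp (fun _ : ℕ => ℂ) 2 →L[ℂ] lp (fun _ : ℕ => ℂ) 2 :=
  weightedShift (fun n => weight₁ s δ j n * weight₂ s δ j n) (bddAbove_schurWeight s δ j)

end HToeplitz

end

/-! On the basis vectors the adjoint acts as `B* e_m = w_m e_{σ m}` with an injective index map `σ`,
so `B*` is a direct sum over the orbits of `σ`. For `m ≥ δ` one has `σ m = 2 (m - δ)`, which doubles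
the distance to `2δ`. Hence `2δ` is fixed (giving `D₁`), the indices below `2δ` are permuted among
themselves (giving `M`), and each index above `2δ` is uniquely `2δ + 2^n l` with `l` odd. The
founders are the numbers `2δ + l`, and along such an orbit `w_m` is the product of the two stated
weights. Since the vectors `e_n` are complete, this orbit decomposition determines `B*`.

Hyponormality of `B*` or `M` is decided by comparing neighbouring weights. For `m ≥ δ` the weights
strictly increase in `m`, and `w_0 = w_δ`. If `δ = 1`, the finite orbit is the swap of `e_0` and
`e_1` with equal weights, so `M` is self-adjoint and the weights never decrease along orbits. If `δ
> 1`, the weight drops on passing from `2δ - 1` to `2δ - 2 = σ (2δ - 1)`, and `w_0 = w_δ < w_{2δ-1}`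
gives the failure for the adjoint of `M`. `B` is never hyponormal because it kills `e_{2δ+1}` while
`B*` does not. The norm bounds hold because `P`, `K` and multiplication by the symbol are
contractions.

For `k`-hyponormality of the shifts, the quadratic form splits into Hankel forms in the moments
(`isKHyponormal_weightedShift`). Here each Hankel matrix is the Schur product of two matrices of
quotients of `q`-Pochhammer products with `q = 1/2`. Such a matrix has an explicit triangular
factorization (`sum_qPivot_mul_qColumn`) whose successive pivots are related by a factor with the
sign of `d q^r - a`. The assumption on `s` makes all these factors nonnegative except possibly the
last, so the Schur product theorem alone does not suffice. A negative last pivot of one factor is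
absorbed by the strict positivity of the corner of the other (`hadamard_qHankel_posSemidef`); the
explicit inequalities `pivot_ratio_bound_left` and `pivot_ratio_bound_right` show that there is
enough room. -/

namespace HToeplitz

/-! ### Triangular factorization of Hankel matrices of `q`-moments. -/

section QHankel

open Finset

/-- The product `(1 + a) (1 + a q) ⋯ (1 + a q ^ (n - 1))`. -/
noncomputable def qRise (q a : ℝ) (n : ℕ) : ℝ := ∏ l ∈ range n, (1 + a * q ^ l)

/-- The moments of a geometrically regular weighted shift. -/
noncomputable def qMoment (q a d : ℝ) (n : ℕ) : ℝ := qRise q a n / qRise q d n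

/-- The columns of a triangular factorization of the Hankel matrix of `qMoment`. -/
noncomputable def qColumn (q a d : ℝ) (r i : ℕ) : ℝ :=
  (∏ l ∈ range r, (q ^ l - q ^ i)) * qRise q a i / qRise q d (i + r)

/-- The ratio of consecutive diagonal entries in the factorization of the Hankel matrix. -/
noncomputable def qRatio (q a d : ℝ) (r : ℕ) : ℝ :=
  (d * q ^ r - a) * (1 + d * q ^ r / q) * (1 + d * q ^ (2 * r + 1)) /
    ((1 + d * q ^ (2 * r) / q) * (1 + a * q ^ r) * (1 - q ^ (r + 1)))

/-- The diagonal entries in the factorization of the Hankel matrix of `qMoment`. -/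
noncomputable def qPivot (q a d : ℝ) (r : ℕ) : ℝ := ∏ l ∈ range r, qRatio q a d l

variable {q a d : ℝ}

theorem qRise_succ (n : ℕ) : qRise q a (n + 1) = qRise q a n * (1 + a * q ^ n) :=
  prod_range_succ _ _

theorem qRise_pos (hq : 0 < q) (ha : 0 ≤ a) (n : ℕ) : 0 < qRise q a n :=
  prod_pos fun _ _ => by positivity

theorem qMoment_pos (hq : 0 < q) (ha : 0 ≤ a) (hd : 0 ≤ d) (n : ℕ) : 0 < qMoment q a d n :=
  div_pos (qRise_pos hq ha n) (qRise_pos hq hd n)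

theorem qMoment_succ (n : ℕ) :
    qMoment q a d (n + 1) = qMoment q a d n * ((1 + a * q ^ n) / (1 + d * q ^ n)) := by
  rw [qMoment, qMoment, qRise_succ, qRise_succ, mul_div_mul_comm]

theorem qColumn_eq_zero {r i : ℕ} (h : i < r) : qColumn q a d r i = 0 := by
  rw [qColumn, prod_eq_zero (mem_range.2 h) (sub_self _), zero_mul, zero_div]

theorem qColumn_zero_left (i : ℕ) : qColumn q a d 0 i = qMoment q a d i := by
  simp [qColumn, qMoment]

theorem qPivot_succ (r : ℕ) : qPivot q a d (r + 1) = qPivot q a d r * qRatio q a d r :=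
  prod_range_succ _ _

/-- Contiguous relation between the columns and their shifts. -/
theorem qColumn_shift (hq : 0 < q) (hd : 0 ≤ d) (r i : ℕ) :
    (∏ l ∈ range r, (q ^ l - q ^ i)) * qRise q a (i + 1) / qRise q d (i + r + 1) =
      (1 + a * q ^ r) / (1 + d * q ^ (2 * r)) * qColumn q a d r i +
        (d * q ^ r - a) / (1 + d * q ^ (2 * r)) * qColumn q a d (r + 1) i := by
  have h1 := (qRise_pos hq hd (i + r)).ne'
  have h2 : 1 + d * q ^ (2 * r) ≠ 0 := by positivity
  have h3 : 1 + d * q ^ (i + r) ≠ 0 := by positivity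
  -- What remains is `(1 + a q^i)(1 + d q^(2r)) = (1 + a q^r)(1 + d q^(i+r)) + (d q^r - a)(q^r -
  -- q^i)`.
  rw [qColumn, qColumn, prod_range_succ, ← add_assoc, qRise_succ, qRise_succ]
  field_simp
  ring

theorem prod_pow_sub_pow_succ (q : ℝ) (r i : ℕ) :
    ∏ l ∈ range (r + 1), (q ^ l - q ^ (i + 1)) =
      (1 - q ^ (i + 1)) * q ^ r * ∏ l ∈ range r, (q ^ l - q ^ i) := by
  rw [prod_range_succ', pow_zero, mul_comm, mul_assoc]
  congr 1
  have : ∀ l, q ^ (l + 1) - q ^ (i + 1) = q * (q ^ l - q ^ i) := fun l => by ring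
  simp only [this, prod_mul_distrib, prod_const, card_range]

/-- Contiguous relation between consecutive entries of the columns. -/
theorem qColumn_succ (hq : 0 < q) (hd : 0 ≤ d) (r i : ℕ) :
    qColumn q a d (r + 1) (i + 1) =
      q ^ r * (1 - q ^ (r + 1)) / (1 + d * q ^ (2 * r + 1)) *
        ((∏ l ∈ range r, (q ^ l - q ^ i)) * qRise q a (i + 1) / qRise q d (i + r + 1)) +
      q ^ (r + 1) * (1 + d * q ^ r) / (1 + d * q ^ (2 * r + 1)) *
        ((∏ l ∈ range (r + 1), (q ^ l - q ^ i)) * qRise q a (i + 1) /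
          qRise q d (i + (r + 1) + 1)) := by
  have h1 := (qRise_pos hq hd (i + r + 1)).ne'
  have h2 : 1 + d * q ^ (2 * r + 1) ≠ 0 := by positivity
  have h3 : 1 + d * q ^ (i + r + 1) ≠ 0 := by positivity
  -- What remains is `(1 - q^(i+1))(1 + d q^(2r+1)) = (1 - q^(r+1))(1 + d q^(i+r+1)) + q (1 + d
  -- q^r)(q^r - q^i)`, up to the factor `q^r`.
  rw [qColumn, prod_pow_sub_pow_succ, prod_range_succ,
    show i + 1 + (r + 1) = i + r + 1 + 1 by ring, show i + (r + 1) + 1 = i + r + 1 + 1 by ring,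
    qRise_succ (i + r + 1)]
  field_simp
  ring

/-- A Christoffel–Darboux identity. The two contiguous relations write column `r` at `i + 1` as a
combination of columns `r - 1`, `r`, `r + 1` at `i`. After antisymmetrization in `i` and `j` the
middle term cancels, and the pivots are chosen so that the outer terms telescope. The left side
measures the failure of the partial sums to be Hankel. -/
theorem sum_qPivot_telescope (hq : 0 < q) (hq1 : q < 1) (ha : 0 ≤ a) (hd : 0 ≤ d) (i j R : ℕ) :
    ∑ r ∈ range (R + 1), qPivot q a d r * (qColumn q a d r (i + 1) * qColumn q a d r j -
        qColumn q a d r i * qColumn q a d r (j + 1)) =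
      qPivot q a d R * (q ^ R * (1 + d * q ^ R / q) / (1 + d * q ^ (2 * R) / q) *
        ((d * q ^ R - a) / (1 + d * q ^ (2 * R)))) *
        (qColumn q a d (R + 1) i * qColumn q a d R j -
          qColumn q a d R i * qColumn q a d (R + 1) j) := by
  induction R with
  | zero =>
    have h := fun i => qColumn_shift (a := a) hq hd 0 i
    have h0 : ∀ i, qColumn q a d 0 (i + 1) =
        (∏ l ∈ range 0, (q ^ l - q ^ i)) * qRise q a (i + 1) / qRise q d (i + 0 + 1) := by
      intro i; simp [qColumn]
    have h2 : 1 + d / q ≠ 0 := by positivity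
    rw [zero_add, sum_range_one, h0, h0, h, h]
    simp only [qPivot, range_zero, prod_empty, pow_zero, mul_zero, mul_one, one_mul, zero_add]
    -- At `r = 0` the factor `1 + d / q`, an extrapolation to exponent `-1`, occurs in numerator and
    -- denominator and cancels.
    rw [div_self h2]
    ring
  | succ R ih =>
    rw [sum_range_succ, ih, qColumn_succ hq hd, qColumn_succ hq hd, qColumn_shift hq hd,
      qColumn_shift hq hd, qColumn_shift hq hd, qColumn_shift hq hd, qPivot_succ]
    -- This is the equation that determines `qRatio`: the coefficient of column `R` in the new term
    -- cancels the old boundary term.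
    have e1 : qRatio q a d R * (q ^ R * (1 - q ^ (R + 1)) / (1 + d * q ^ (2 * R + 1))) *
        ((1 + a * q ^ R) / (1 + d * q ^ (2 * R))) =
        q ^ R * (1 + d * q ^ R / q) / (1 + d * q ^ (2 * R) / q) *
        ((d * q ^ R - a) / (1 + d * q ^ (2 * R))) := by
      have h1 : 1 - q ^ (R + 1) ≠ 0 := (sub_pos.2 (pow_lt_one₀ hq.le hq1 R.succ_ne_zero)).ne'
      have h2 : 1 + d * q ^ (2 * R) ≠ 0 := by positivity
      have h3 : 1 + a * q ^ R ≠ 0 := by positivity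
      have h4 : 1 + d * q ^ (2 * R + 1) ≠ 0 := by positivity
      have h5 : 1 + d * q ^ (2 * R) / q ≠ 0 := by positivity
      rw [qRatio]
      generalize 1 - q ^ (R + 1) = A at *
      generalize 1 + d * q ^ (2 * R) = B at *
      generalize 1 + a * q ^ R = C at *
      generalize 1 + d * q ^ (2 * R + 1) = E at *
      generalize 1 + d * q ^ (2 * R) / q = F at *
      generalize 1 + d * q ^ R / q = G at *
      field_simp
    have e2 : q ^ (R + 1) * (1 + d * q ^ (R + 1) / q) / (1 + d * q ^ (2 * (R + 1)) / q) =
        q ^ (R + 1) * (1 + d * q ^ R) / (1 + d * q ^ (2 * R + 1)) := by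
      rw [show d * q ^ (R + 1) / q = d * q ^ R by field_simp; ring,
        show d * q ^ (2 * (R + 1)) / q = d * q ^ (2 * R + 1) by field_simp; ring]
    rw [e2, ← e1]
    ring

/-- The boundary term of the telescoping sum vanishes by triangularity, so the sum depends only on
`i + j`. It is therefore enough to evaluate it at `i = 0`, where only column `0`, the moment
sequence itself, contributes. -/
theorem sum_qPivot_mul_qColumn (hq : 0 < q) (hq1 : q < 1) (ha : 0 ≤ a) (hd : 0 ≤ d)
    (R i j : ℕ) (hi : i < R) :
    ∑ r ∈ range R, qPivot q a d r * (qColumn q a d r i * qColumn q a d r j) =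
      qMoment q a d (i + j) := by
  induction i generalizing j with
  | zero =>
    rw [sum_eq_single_of_mem 0 (mem_range.2 hi)]
    · simp [qPivot, qColumn_zero_left, qMoment, qRise]
    · intro r _ hr
      rw [qColumn_eq_zero (Nat.pos_of_ne_zero hr)]
      simp
  | succ i ih =>
    rw [show i + 1 + j = i + (j + 1) by ring, ← ih (j + 1) (by omega), ← sub_eq_zero,
      ← sum_sub_distrib]
    obtain ⟨R, rfl⟩ := Nat.exists_eq_succ_of_ne_zero (show R ≠ 0 by omega)
    simp only [← mul_sub]
    rw [Nat.succ_eq_add_one, sum_qPivot_telescope hq hq1 ha hd,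
      qColumn_eq_zero (show i < R by omega), qColumn_eq_zero (show i < R + 1 by omega)]
    simp

end QHankel

/-! ### Positivity of Schur products with a possibly negative last pivot. -/

section QHankelPositive

open Finset Matrix

/-- The Hankel matrix of size `k + 1` of the moments `qMoment`. -/
noncomputable def qHankel (q a d : ℝ) (k : ℕ) : Matrix (Fin (k + 1)) (Fin (k + 1)) ℝ :=
  Matrix.of fun i j => qMoment q a d (i + j)

theorem posSemidef_smul_vecMulVec {ι : Type*} [Fintype ι] {c : ℝ} (hc : 0 ≤ c) (v : ι → ℝ) :
    (c • vecMulVec v v).PosSemidef := by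
  simpa using (posSemidef_vecMulVec_self_star v).smul hc

/-- A criterion for the Schur product of two matrices to be positive semidefinite when both of
them become so after an increase of one diagonal entry. -/
theorem posSemidef_hadamard_of_deficit {ι : Type*} [Fintype ι] [DecidableEq ι]
    {H₁ H₂ : Matrix ι ι ℝ} {l : ι} {v₁ v₂ : ι → ℝ} {p₁ p₂ e₁ e₂ s₁ s₂ : ℝ}
    (hp₁ : 0 ≤ p₁) (hp₂ : 0 ≤ p₂)
    (h₁ : (H₁ + diagonal (Pi.single l e₁) - p₁ • vecMulVec v₁ v₁).PosSemidef)
    (h₂ : (H₂ + diagonal (Pi.single l e₂) - p₂ • vecMulVec v₂ v₂).PosSemidef)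
    (h₁₂ : ((p₁ • vecMulVec v₁ v₁) ⊙ H₂ - diagonal (Pi.single l s₂)).PosSemidef)
    (h₂₁ : ((p₂ • vecMulVec v₂ v₂) ⊙ H₁ - diagonal (Pi.single l s₁)).PosSemidef)
    (h : e₁ * H₂ l l + e₂ * H₁ l l + e₁ * e₂ ≤
      (s₁ + s₂ + e₂ * (p₁ * v₁ l ^ 2) + e₁ * (p₂ * v₂ l ^ 2)) / 2) :
    (H₁ ⊙ H₂).PosSemidef := by
  have hP₁ : (H₁ + diagonal (Pi.single l e₁)).PosSemidef := by
    simpa using h₁.add (posSemidef_smul_vecMulVec hp₁ v₁)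
  have hP₂ : (H₂ + diagonal (Pi.single l e₂)).PosSemidef := by
    simpa using h₂.add (posSemidef_smul_vecMulVec hp₂ v₂)
  have hD : (diagonal (Pi.single l ((s₁ + s₂ + e₂ * (p₁ * v₁ l ^ 2) + e₁ * (p₂ * v₂ l ^ 2)) / 2 -
      (e₁ * H₂ l l + e₂ * H₁ l l + e₁ * e₂))) : Matrix ι ι ℝ).PosSemidef := by
    refine PosSemidef.diagonal fun i => ?_
    by_cases hi : i = l
    · subst hi; simpa using h
    · simp [hi]
  -- Expand the product of the two corrected matrices twice, splitting the rank-one part off the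
  -- first factor and then off the second, and average. Everything but a multiple of the diagonal
  -- unit at `l` is then a sum of positive semidefinite Schur products.
  have key : H₁ ⊙ H₂ = (1 / 2 : ℝ) • ((H₁ + diagonal (Pi.single l e₁) - p₁ • vecMulVec v₁ v₁) ⊙
        (H₂ + diagonal (Pi.single l e₂)) +
      (H₂ + diagonal (Pi.single l e₂) - p₂ • vecMulVec v₂ v₂) ⊙
        (H₁ + diagonal (Pi.single l e₁)) +
      ((p₁ • vecMulVec v₁ v₁) ⊙ H₂ - diagonal (Pi.single l s₂)) +
      ((p₂ • vecMulVec v₂ v₂) ⊙ H₁ - diagonal (Pi.single l s₁))) +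
      diagonal (Pi.single l ((s₁ + s₂ + e₂ * (p₁ * v₁ l ^ 2) + e₁ * (p₂ * v₂ l ^ 2)) / 2 -
      (e₁ * H₂ l l + e₂ * H₁ l l + e₁ * e₂))) := by
    ext i j
    by_cases hij : i = j
    · subst hij
      by_cases hi : i = l
      · subst hi
        simp [vecMulVec_apply]
        ring
      · simp [vecMulVec_apply, hi]
        ring
    · simp [vecMulVec_apply, hij]
      ring
  rw [key]
  exact (((((h₁.hadamard hP₂).add (h₂.hadamard hP₁)).add h₁₂).add h₂₁).smul
    (by norm_num : (0 : ℝ) ≤ 1 / 2)).add hD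

variable {q a b d : ℝ}

theorem qRatio_nonneg (hq : 0 < q) (hq1 : q < 1) (ha : 0 ≤ a) (hd : 0 ≤ d) {r : ℕ}
    (h : a ≤ d * q ^ r) : 0 ≤ qRatio q a d r := by
  have h1 : 0 < 1 - q ^ (r + 1) := sub_pos.2 (pow_lt_one₀ hq.le hq1 r.succ_ne_zero)
  have h2 : 0 ≤ d * q ^ r - a := sub_nonneg.2 h
  unfold qRatio
  positivity

theorem qPivot_nonneg (hq : 0 < q) (hq1 : q < 1) (ha : 0 ≤ a) (hd : 0 ≤ d) {R : ℕ}
    (h : ∀ r < R, a ≤ d * q ^ r) {r : ℕ} (hr : r ≤ R) : 0 ≤ qPivot q a d r :=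
  prod_nonneg fun l hl => qRatio_nonneg hq hq1 ha hd (h l ((mem_range.1 hl).trans_le hr))

/-- The factorization of the Hankel matrix. -/
theorem qHankel_eq_sum (hq : 0 < q) (hq1 : q < 1) (ha : 0 ≤ a) (hd : 0 ≤ d) (k : ℕ) :
    qHankel q a d k = ∑ r ∈ range (k + 1), qPivot q a d r •
      vecMulVec (fun i : Fin (k + 1) => qColumn q a d r i) (fun i : Fin (k + 1) => qColumn q a d r i) := by
  ext i j
  simp only [qHankel, Matrix.of_apply, Matrix.sum_apply, Matrix.smul_apply, vecMulVec_apply,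
    smul_eq_mul]
  exact (sum_qPivot_mul_qColumn hq hq1 ha hd (k + 1) i j i.2).symm

theorem qHankel_posSemidef (hq : 0 < q) (hq1 : q < 1) (ha : 0 ≤ a) (hd : 0 ≤ d) {k : ℕ}
    (h : ∀ r < k, a ≤ d * q ^ r) : (qHankel q a d k).PosSemidef := by
  rw [qHankel_eq_sum hq hq1 ha hd]
  exact posSemidef_sum _ fun r hr => posSemidef_smul_vecMulVec
    (qPivot_nonneg hq hq1 ha hd h (Nat.lt_succ_iff.1 (mem_range.1 hr))) _

/-- Column `K + 1` is supported on the last index, so the only pivot of unknown sign affects a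
single diagonal entry and `e` repairs it. The rank-one term of column `K` is held back to pay for
this repair. -/
theorem qHankel_deficit (hq : 0 < q) (hq1 : q < 1) (ha : 0 ≤ a) (hd : 0 ≤ d) {K : ℕ}
    (h : ∀ r < K, a ≤ d * q ^ r) {e : ℝ}
    (he : 0 ≤ qPivot q a d (K + 1) * qColumn q a d (K + 1) (K + 1) ^ 2 + e) :
    (qHankel q a d (K + 1) + diagonal (Pi.single (Fin.last (K + 1)) e) -
      qPivot q a d K • vecMulVec (fun i : Fin (K + 1 + 1) => qColumn q a d K i)
        (fun i : Fin (K + 1 + 1) => qColumn q a d K i)).PosSemidef := by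
  have key : qHankel q a d (K + 1) + diagonal (Pi.single (Fin.last (K + 1)) e) -
      qPivot q a d K • vecMulVec (fun i : Fin (K + 1 + 1) => qColumn q a d K i)
        (fun i : Fin (K + 1 + 1) => qColumn q a d K i) =
      ∑ r ∈ range K, qPivot q a d r •
        vecMulVec (fun i : Fin (K + 1 + 1) => qColumn q a d r i) (fun i : Fin (K + 1 + 1) => qColumn q a d r i) +
      diagonal (Pi.single (Fin.last (K + 1))
        (qPivot q a d (K + 1) * qColumn q a d (K + 1) (K + 1) ^ 2 + e)) := by
    have hlast : qPivot q a d (K + 1) • vecMulVec (fun i : Fin (K + 1 + 1) =>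
        qColumn q a d (K + 1) i) (fun i : Fin (K + 1 + 1) => qColumn q a d (K + 1) i) =
        diagonal (Pi.single (Fin.last (K + 1))
          (qPivot q a d (K + 1) * qColumn q a d (K + 1) (K + 1) ^ 2)) := by
      have hz : ∀ i : Fin (K + 1 + 1), i ≠ Fin.last (K + 1) → qColumn q a d (K + 1) i = 0 :=
        fun i hi => qColumn_eq_zero (Fin.lt_last_iff_ne_last.2 hi)
      ext i j
      by_cases hi : i = Fin.last (K + 1)
      · subst hi
        by_cases hj : j = Fin.last (K + 1)
        · subst hj; simp [vecMulVec_apply, sq]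
        · simp [vecMulVec_apply, hz j hj, Ne.symm hj]
      · by_cases hij : i = j
        · subst hij; simp [vecMulVec_apply, hz i hi, hi]
        · simp [vecMulVec_apply, hz i hi, hij]
    have hadd : ∀ x y : ℝ, diagonal (Pi.single (Fin.last (K + 1)) (x + y)) =
        diagonal (Pi.single (Fin.last (K + 1)) x) + diagonal (Pi.single (Fin.last (K + 1)) y) :=
      fun x y => by rw [Pi.single_add]; exact (diagonal_add _ _).symm
    rw [qHankel_eq_sum hq hq1 ha hd, sum_range_succ, sum_range_succ, hlast, hadd]
    abel
  rw [key]
  refine (posSemidef_sum _ fun r hr => posSemidef_smul_vecMulVec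
    (qPivot_nonneg hq hq1 ha hd h (mem_range.1 hr).le) _).add (PosSemidef.diagonal fun i => ?_)
  by_cases hi : i = Fin.last (K + 1)
  · subst hi; simpa using he
  · simp [hi]

/-- The relative Schur complement of the last `2 × 2` block of the Hankel matrix. -/
noncomputable def qGap (q a d : ℝ) (K : ℕ) : ℝ :=
  1 - qMoment q a d (2 * K + 1) ^ 2 / (qMoment q a d (2 * K) * qMoment q a d (2 * K + 2))

/-- The vector `v` lives on the last two indices, so only the last `2 × 2` block of the Hankel
matrix matters. Subtracting its Schur complement from the lower right entry leaves a rank-one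
matrix. -/
theorem qHankel_corner (hq : 0 < q) (ha : 0 ≤ a) (hd : 0 ≤ d) {K : ℕ} {p : ℝ} (hp : 0 ≤ p)
    {v : ℕ → ℝ} (hv : ∀ i < K, v i = 0) :
    ((p • vecMulVec (fun i : Fin (K + 1 + 1) => v i) (fun i : Fin (K + 1 + 1) => v i)) ⊙ qHankel q a d (K + 1) -
      diagonal (Pi.single (Fin.last (K + 1))
        (qGap q a d K * qMoment q a d (2 * K + 2) * (p * v (K + 1) ^ 2)))).PosSemidef := by
  have h0 := qMoment_pos hq ha hd (2 * K)
  have h1 := qMoment_pos hq ha hd (2 * K + 1)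
  have h2 := qMoment_pos hq ha hd (2 * K + 2)
  have key : (p • vecMulVec (fun i : Fin (K + 1 + 1) => v i) (fun i : Fin (K + 1 + 1) => v i)) ⊙
        qHankel q a d (K + 1) - diagonal (Pi.single (Fin.last (K + 1))
        (qGap q a d K * qMoment q a d (2 * K + 2) * (p * v (K + 1) ^ 2))) =
      (p / qMoment q a d (2 * K)) •
        vecMulVec (fun i : Fin (K + 1 + 1) => v i * qMoment q a d (K + i))
          (fun i : Fin (K + 1 + 1) => v i * qMoment q a d (K + i)) := by
    have hcase : ∀ i : Fin (K + 1 + 1), (i : ℕ) < K ∨ (i : ℕ) = K ∨ i = Fin.last (K + 1) := by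
      intro i
      have := i.2
      rw [Fin.ext_iff, Fin.val_last]
      omega
    have hne : ∀ i : Fin (K + 1 + 1), (i : ℕ) = K → i ≠ Fin.last (K + 1) := by
      rintro i hi rfl
      simp at hi
    ext i j
    simp only [Matrix.sub_apply, hadamard_apply, Matrix.smul_apply, vecMulVec_apply, smul_eq_mul,
      qHankel, Matrix.of_apply]
    rcases hcase i with hi | hi | hi
    · have : i ≠ Fin.last (K + 1) := by rintro rfl; simp at hi
      by_cases hij : i = j
      · subst hij; simp [hv _ hi, this]
      · simp [hv _ hi, hij]
    · rcases hcase j with hj | hj | hj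
      · have : i ≠ j := by rintro rfl; omega
        simp [hv _ hj, this]
      · obtain rfl : i = j := Fin.ext (hi.trans hj.symm)
        simp only [diagonal_apply_eq, hi, Pi.single_eq_of_ne (hne i hi)]
        rw [← two_mul]
        field_simp
        ring
      · subst hj
        rw [diagonal_apply_ne _ (hne i hi), hi, Fin.val_last, show K + (K + 1) = 2 * K + 1 by ring,
          ← two_mul]
        field_simp
        ring
    · subst hi
      rcases hcase j with hj | hj | hj
      · have : Fin.last (K + 1) ≠ j := by rintro rfl; simp at hj
        simp [hv _ hj, this]
      · rw [diagonal_apply_ne _ (hne j hj).symm, hj, Fin.val_last,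
          show K + 1 + K = 2 * K + 1 by ring, show K + (K + 1) = 2 * K + 1 by ring, ← two_mul]
        field_simp
        ring
      · subst hj
        rw [diagonal_apply_eq, Pi.single_eq_same, Fin.val_last,
          show K + 1 + (K + 1) = 2 * K + 2 by ring, show K + (K + 1) = 2 * K + 1 by ring, qGap]
        field_simp
        ring
  rw [key]
  exact posSemidef_smul_vecMulVec (by positivity) _

theorem qGap_eq (hq : 0 < q) (ha : 0 ≤ a) (hd : 0 ≤ d) (K : ℕ) :
    qGap q a d K = 1 - (1 + a * q ^ (2 * K)) * (1 + d * q ^ (2 * K + 1)) /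
      ((1 + d * q ^ (2 * K)) * (1 + a * q ^ (2 * K + 1))) := by
  have h0 := qMoment_pos hq ha hd (2 * K)
  rw [qGap, qMoment_succ (2 * K + 1), qMoment_succ (2 * K)]
  have h1 : 1 + d * q ^ (2 * K) ≠ 0 := by positivity
  have h2 : 1 + a * q ^ (2 * K + 1) ≠ 0 := by positivity
  have h3 : 1 + d * q ^ (2 * K + 1) ≠ 0 := by positivity
  have h4 : 1 + a * q ^ (2 * K) ≠ 0 := by positivity
  field_simp

theorem qGap_le_one (hq : 0 < q) (ha : 0 ≤ a) (hd : 0 ≤ d) (K : ℕ) : qGap q a d K ≤ 1 := by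
  rw [qGap_eq hq ha hd]
  have : 0 ≤ (1 + a * q ^ (2 * K)) * (1 + d * q ^ (2 * K + 1)) /
      ((1 + d * q ^ (2 * K)) * (1 + a * q ^ (2 * K + 1))) := by positivity
  linarith

/-- The Schur product of two Hankel matrices, each of which may have one small negative pivot, is
positive semidefinite. -/
theorem hadamard_qHankel_posSemidef (hq : 0 < q) (hq1 : q < 1) (ha : 0 ≤ a) (hb : 0 ≤ b)
    (hd : 0 ≤ d) {K : ℕ} (hga : 0 ≤ qGap q a d K) (hgb : 0 ≤ qGap q b d K)
    (had : ∀ r < K, a ≤ d * q ^ r) (hbd : ∀ r < K, b ≤ d * q ^ r)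
    (hab : -(qRatio q a d K * (q ^ K * (1 - q) / (1 + d * q ^ (2 * K + 1))) ^ 2) ≤
      qGap q b d K / 2)
    (hba : -(qRatio q b d K * (q ^ K * (1 - q) / (1 + d * q ^ (2 * K + 1))) ^ 2) ≤
      qGap q a d K / 2) :
    (qHankel q a d (K + 1) ⊙ qHankel q b d (K + 1)).PosSemidef := by
  -- The ratio of the last entries of columns `K + 1` and `K` does not depend on `c`; it converts
  -- the last pivot into a multiple of the held-back term.
  have hcol : ∀ c : ℝ, qColumn q c d (K + 1) (K + 1) =
      qColumn q c d K (K + 1) * (q ^ K * (1 - q) / (1 + d * q ^ (2 * K + 1))) := by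
    intro c
    have h1 := (qRise_pos hq hd (K + 1 + K)).ne'
    have h2 : 1 + d * q ^ (2 * K + 1) ≠ 0 := by positivity
    rw [qColumn, qColumn, prod_range_succ, ← add_assoc, qRise_succ (K + 1 + K),
      show K + 1 + K = 2 * K + 1 by ring] at *
    field_simp
    ring
  have hpa := qPivot_nonneg hq hq1 ha hd had le_rfl
  have hpb := qPivot_nonneg hq hq1 hb hd hbd le_rfl
  -- The smallest nonnegative correction: zero unless the last pivot is negative.
  set ea := max 0 (-(qPivot q a d (K + 1) * qColumn q a d (K + 1) (K + 1) ^ 2)) with hea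
  set eb := max 0 (-(qPivot q b d (K + 1) * qColumn q b d (K + 1) (K + 1) ^ 2)) with heb
  have hea0 : 0 ≤ ea := le_max_left _ _
  have heb0 : 0 ≤ eb := le_max_left _ _
  set ta := qPivot q a d K * qColumn q a d K (K + 1) ^ 2 with hta
  set tb := qPivot q b d K * qColumn q b d K (K + 1) ^ 2 with htb
  have hta0 : 0 ≤ ta := by positivity
  have htb0 : 0 ≤ tb := by positivity
  have hea1 : ea ≤ qGap q b d K / 2 * ta := by
    refine max_le (by positivity) ?_
    rw [hcol, qPivot_succ]
    calc _ = -(qRatio q a d K * (q ^ K * (1 - q) / (1 + d * q ^ (2 * K + 1))) ^ 2) * ta := by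
          rw [hta]; ring
      _ ≤ _ := mul_le_mul_of_nonneg_right hab hta0
  have heb1 : eb ≤ qGap q a d K / 2 * tb := by
    refine max_le (by positivity) ?_
    rw [hcol, qPivot_succ]
    calc _ = -(qRatio q b d K * (q ^ K * (1 - q) / (1 + d * q ^ (2 * K + 1))) ^ 2) * tb := by
          rw [htb]; ring
      _ ≤ _ := mul_le_mul_of_nonneg_right hba htb0
  refine posSemidef_hadamard_of_deficit hpa hpb
    (qHankel_deficit hq hq1 ha hd had (e := ea) ?_)
    (qHankel_deficit hq hq1 hb hd hbd (e := eb) ?_)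
    (qHankel_corner hq hb hd hpa fun i hi => qColumn_eq_zero hi)
    (qHankel_corner hq ha hd hpb fun i hi => qColumn_eq_zero hi) ?_
  · linarith [le_max_right 0 (-(qPivot q a d (K + 1) * qColumn q a d (K + 1) (K + 1) ^ 2))]
  · linarith [le_max_right 0 (-(qPivot q b d (K + 1) * qColumn q b d (K + 1) (K + 1) ^ 2))]
  · have hma := (qMoment_pos hq ha hd (2 * K + 2)).le
    have hmb := (qMoment_pos hq hb hd (2 * K + 2)).le
    simp only [qHankel, Matrix.of_apply, Fin.val_last]
    rw [show K + 1 + (K + 1) = 2 * K + 2 by ring, ← hta, ← htb]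
    have h1 := mul_le_mul_of_nonneg_right hea1 hmb
    have h2 := mul_le_mul_of_nonneg_right heb1 hma
    -- The cross term of the two corrections is paid by one of the mixed terms, since the gap is at
    -- most `1`.
    have h3 : ea * eb ≤ eb * ta / 2 := by
      have : ea ≤ ta / 2 := hea1.trans (by nlinarith [qGap_le_one hq hb hd K])
      nlinarith
    have h4 : 0 ≤ ea * tb := by positivity
    nlinarith

end QHankelPositive

/-! ### The case `q = 1/2`: numerical bounds on the last pivot. -/

section HalfHankel

open Matrix

/-- Used with `n = 2δ + 1`, `m = δ + 1`, `D = 2δ + s + 1` and `h = 2^(-K)`; then `hD` is `2^K (2δ +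
1) ≤ 2 (s + 1)`. It bounds the deficit of the factor with numerator parameter `n` by the gap of the
other one. The worst case `h = 1/2` is separate: there only `D ≥ 2n - 1` is available, against `D ≥
3n - 1` for `h ≤ 1/4`. -/
theorem pivot_ratio_bound_left {n m D u h : ℝ} (hn : 3 ≤ n) (hm : 2 * m = n + 1) (hu : 0 ≤ u)
    (hh : 0 < h) (hh' : h = 1 / 2 ∨ h ≤ 1 / 4) (hD : n * (1 + 2 * h) - 2 * h ≤ 2 * h * D) :
    (n - D * h) * (1 + 2 * (D * u) * h) * (1 + D * u * h ^ 2) * (1 + m * u * (h ^ 2 / 2)) ≤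
      (D - m) * (1 + 2 * (D * u) * h ^ 2) * (1 + n * u * h) * (1 - h / 2) *
        (1 + D * u * (h ^ 2 / 2)) := by
  rcases hh' with rfl | hh'
  · have hD' : 2 * n - 1 ≤ D := by linarith
    have h1 : (n - D * (1 / 2)) * (1 + 2 * (D * u) * (1 / 2)) ≤ 1 + D * u * (1 / 2) := by
      have : 0 ≤ D * u := by nlinarith
      nlinarith
    have hDu : 0 ≤ D * u := by nlinarith
    have hmu : 0 ≤ m * u := by nlinarith
    have hmn : m * u ≤ n * u := mul_le_mul_of_nonneg_right (by linarith) hu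
    have hDm : 3 ≤ D - m := by linarith
    calc (n - D * (1 / 2)) * (1 + 2 * (D * u) * (1 / 2)) * (1 + D * u * (1 / 2) ^ 2) *
          (1 + m * u * ((1 / 2) ^ 2 / 2))
        ≤ (1 + D * u * (1 / 2)) * (1 + D * u * (1 / 2) ^ 2) *
          (1 + m * u * ((1 / 2) ^ 2 / 2)) := by gcongr
      _ ≤ (1 + D * u * (1 / 2)) * (2 * (1 + D * u * ((1 / 2) ^ 2 / 2))) *
          (1 + n * u * (1 / 2)) := by gcongr ?_ * ?_ * ?_ <;> nlinarith
      _ = 2 * ((1 + D * u * (1 / 2)) * (1 + D * u * ((1 / 2) ^ 2 / 2)) *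
          (1 + n * u * (1 / 2))) := by ring
      _ ≤ ((D - m) * (3 / 4)) * ((1 + D * u * (1 / 2)) * (1 + D * u * ((1 / 2) ^ 2 / 2)) *
          (1 + n * u * (1 / 2))) := by
          have : 0 ≤ n * u := by positivity
          gcongr
          linarith
      _ = _ := by ring
  · have hDh : n / 2 ≤ D * h := by nlinarith
    have hD' : 3 * n - 1 ≤ D := by
      have : n * (1 / 2 - 2 * h) ≥ 0 := mul_nonneg (by linarith) (by linarith)
      by_contra hlt
      push Not at hlt
      nlinarith
    have hD0 : 0 < D := by linarith
    set X := n * u * h with hX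
    set Y := D * u * (h ^ 2 / 2) with hY
    have hX0 : 0 ≤ X := by positivity
    have hY0 : 0 ≤ Y := by positivity
    have hXY : X ≤ 4 * Y := by
      have : n * (u * h) ≤ 2 * (D * h) * (u * h) :=
        mul_le_mul_of_nonneg_right (by linarith) (by positivity)
      rw [hX, hY]; nlinarith
    have hm4 : m ≤ D / 4 := by linarith
    have hZ : m * u * (h ^ 2 / 2) ≤ Y / 4 := by
      have : m * (u * (h ^ 2 / 2)) ≤ D / 4 * (u * (h ^ 2 / 2)) :=
        mul_le_mul_of_nonneg_right hm4 (by positivity)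
      rw [hY]; linarith
    have h1 : (n - D * h) * (1 + 2 * (D * u) * h) ≤ D * (1 / 4 + X) := by
      have h2 : (n - D * h) * (1 + 2 * (D * u) * h) ≤ n / 2 * (1 + 2 * (D * u) * h) :=
        mul_le_mul_of_nonneg_right (by linarith) (by positivity)
      have h3 : n / 2 * (1 + 2 * (D * u) * h) = n / 2 + D * X := by rw [hX]; ring
      have h4 : n / 2 ≤ D / 4 := by nlinarith
      linarith
    -- The constant is `21/32 = 3/4 · 7/8`, from `D - m ≥ 3/4 D` and `1 - h/2 ≥ 7/8`.
    have h5 : (1 / 4 + X) * ((1 + 2 * Y) * (1 + Y / 4)) ≤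
        21 / 32 * ((1 + 4 * Y) * (1 + X) * (1 + Y)) := by
      have h6 : 0 ≤ X * Y := by positivity
      have h7 : 0 ≤ X * Y ^ 2 := by positivity
      nlinarith [sq_nonneg Y]
    calc (n - D * h) * (1 + 2 * (D * u) * h) * (1 + D * u * h ^ 2) * (1 + m * u * (h ^ 2 / 2))
        = (n - D * h) * (1 + 2 * (D * u) * h) *
            ((1 + 2 * Y) * (1 + m * u * (h ^ 2 / 2))) := by rw [hY]; ring
      _ ≤ D * (1 / 4 + X) * ((1 + 2 * Y) * (1 + Y / 4)) := by
          have : 0 ≤ m * u * (h ^ 2 / 2) := by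
            have : 0 ≤ m := by linarith
            positivity
          gcongr
      _ = D * ((1 / 4 + X) * ((1 + 2 * Y) * (1 + Y / 4))) := by ring
      _ ≤ D * (21 / 32 * ((1 + 4 * Y) * (1 + X) * (1 + Y))) := by gcongr
      _ = (3 / 4 * D * (7 / 8)) * ((1 + 4 * Y) * (1 + X) * (1 + Y)) := by ring
      _ ≤ ((D - m) * (1 - h / 2)) * ((1 + 4 * Y) * (1 + X) * (1 + Y)) := by
          gcongr <;> linarith
      _ = _ := by rw [hY]; ring

/-- The same comparison with the factors exchanged. For `h = 1/2` there is no deficit, as `m ≤ D /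
2`; for `h ≤ 1/4` it is small, because `m - D h ≤ m - n / 2 = 1/2`. -/
theorem pivot_ratio_bound_right {n m D u h : ℝ} (hn : 3 ≤ n) (hm : 2 * m = n + 1) (hu : 0 ≤ u)
    (hh : 0 < h) (hh' : h = 1 / 2 ∨ h ≤ 1 / 4) (hD : n * (1 + 2 * h) - 2 * h ≤ 2 * h * D) :
    (m - D * h) * (1 + 2 * (D * u) * h) * (1 + D * u * h ^ 2) * (1 + n * u * (h ^ 2 / 2)) ≤
      (D - n) * (1 + 2 * (D * u) * h ^ 2) * (1 + m * u * h) * (1 - h / 2) *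
        (1 + D * u * (h ^ 2 / 2)) := by
  have hm0 : 2 ≤ m := by linarith
  rcases hh' with rfl | hh'
  · have hD' : 2 * n - 1 ≤ D := by linarith
    have hD0 : 0 < D := by linarith
    have h1 : (m - D * (1 / 2)) * ((1 + 2 * (D * u) * (1 / 2)) * (1 + D * u * (1 / 2) ^ 2) *
        (1 + n * u * ((1 / 2) ^ 2 / 2))) ≤ 0 :=
      mul_nonpos_of_nonpos_of_nonneg (by linarith) (by positivity)
    have h2 : 0 ≤ (D - n) * ((1 + 2 * (D * u) * (1 / 2) ^ 2) * (1 + m * u * (1 / 2)) *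
        (1 - 1 / 2 / 2) * (1 + D * u * ((1 / 2) ^ 2 / 2))) :=
      mul_nonneg (by linarith) (by norm_num; positivity)
    linarith
  · have hDh : n / 2 ≤ D * h := by nlinarith
    have hD' : 3 * n - 1 ≤ D := by
      have : n * (1 / 2 - 2 * h) ≥ 0 := mul_nonneg (by linarith) (by linarith)
      by_contra hlt
      push Not at hlt
      nlinarith
    have hD0 : 0 < D := by linarith
    set X := m * u * h with hX
    set Y := D * u * (h ^ 2 / 2) with hY
    have hX0 : 0 ≤ X := by positivity
    have hY0 : 0 ≤ Y := by positivity
    have hZ : n * u * (h ^ 2 / 2) ≤ Y := by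
      rw [hY]; gcongr; linarith
    have h1 : (m - D * h) * (1 + 2 * (D * u) * h) ≤ D / 2 * (1 + X) := by
      have h2 : (m - D * h) * (1 + 2 * (D * u) * h) ≤ 1 / 2 * (1 + 2 * (D * u) * h) :=
        mul_le_mul_of_nonneg_right (by linarith) (by positivity)
      have h3 : 2 * (D * u * h) ≤ m * (D * u * h) :=
        mul_le_mul_of_nonneg_right hm0 (by positivity)
      rw [hX]
      nlinarith
    calc (m - D * h) * (1 + 2 * (D * u) * h) * (1 + D * u * h ^ 2) * (1 + n * u * (h ^ 2 / 2))
        = (m - D * h) * (1 + 2 * (D * u) * h) *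
            ((1 + 2 * Y) * (1 + n * u * (h ^ 2 / 2))) := by rw [hY]; ring
      _ ≤ D / 2 * (1 + X) * ((1 + 4 * Y) * (1 + Y)) := by
          gcongr
          norm_num
      _ ≤ ((D - n) * (1 - h / 2)) * (1 + X) * ((1 + 4 * Y) * (1 + Y)) := by
          gcongr
          nlinarith
      _ = _ := by rw [hY]; ring

theorem qGap_half {a d : ℝ} (ha : 0 ≤ a) (hd : 0 ≤ d) (K : ℕ) :
    qGap (1 / 2) a d K = (d - a) * (((1 / 2) ^ K) ^ 2 / 2) /
      ((1 + d * ((1 / 2) ^ K) ^ 2) * (1 + a * (((1 / 2) ^ K) ^ 2 / 2))) := by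
  rw [qGap_eq (by norm_num) ha hd, pow_succ, mul_comm 2 K, pow_mul]
  set h : ℝ := (1 / 2) ^ K
  have h1 : 1 + d * h ^ 2 ≠ 0 := by positivity
  have h2 : 1 + a * (h ^ 2 * (1 / 2)) ≠ 0 := by positivity
  have h3 : 1 + a * (h ^ 2 / 2) ≠ 0 := by positivity
  field_simp
  ring

/-- Both sides contain the factor `u (1/2)^(2K) / 4`; without it and the denominators, the claim is
the polynomial inequality in the hypothesis. -/
theorem qRatio_half_le {n m D u : ℝ} {K : ℕ} (hn : 0 ≤ n) (hm : 0 ≤ m) (hD : 0 ≤ D) (hu : 0 ≤ u)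
    (h : (n - D * (1 / 2) ^ K) * (1 + 2 * (D * u) * (1 / 2) ^ K) *
        (1 + D * u * ((1 / 2) ^ K) ^ 2) * (1 + m * u * (((1 / 2) ^ K) ^ 2 / 2)) ≤
      (D - m) * (1 + 2 * (D * u) * ((1 / 2) ^ K) ^ 2) * (1 + n * u * (1 / 2) ^ K) *
        (1 - (1 / 2) ^ K / 2) * (1 + D * u * (((1 / 2) ^ K) ^ 2 / 2))) :
    -(qRatio (1 / 2) (n * u) (D * u) K *
        ((1 / 2) ^ K * (1 - 1 / 2) / (1 + D * u * (1 / 2) ^ (2 * K + 1))) ^ 2) ≤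
      qGap (1 / 2) (m * u) (D * u) K / 2 := by
  rw [qGap_half (by positivity) (by positivity), qRatio, pow_succ _ (2 * K), mul_comm 2 K, pow_mul,
    pow_succ (1 / 2 : ℝ) K]
  have hx1 : ((1 : ℝ) / 2) ^ K ≤ 1 := pow_le_one₀ (by norm_num) (by norm_num)
  have hx0 : (0 : ℝ) < (1 / 2) ^ K := by positivity
  generalize ((1 : ℝ) / 2) ^ K = x at *
  have h1 : 0 < 1 - x / 2 := by linarith
  have e1 : -((D * u * x - n * u) * (1 + D * u * x / (1 / 2)) * (1 + D * u * (x ^ 2 * (1 / 2))) /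
      ((1 + D * u * x ^ 2 / (1 / 2)) * (1 + n * u * x) * (1 - x * (1 / 2))) *
      (x * (1 - 1 / 2) / (1 + D * u * (x ^ 2 * (1 / 2)))) ^ 2) =
      u * (x ^ 2 / 4) * ((n - D * x) * (1 + 2 * (D * u) * x)) /
        ((1 + 2 * (D * u) * x ^ 2) * (1 + n * u * x) * (1 - x / 2) *
          (1 + D * u * (x ^ 2 / 2))) := by
    have h2 : 1 + 2 * (D * u) * x ^ 2 ≠ 0 := by positivity
    have h3 : 1 + n * u * x ≠ 0 := by positivity
    have h4 : 1 + D * u * (x ^ 2 / 2) ≠ 0 := by positivity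
    rw [show 1 + D * u * x ^ 2 / (1 / 2) = 1 + 2 * (D * u) * x ^ 2 by ring,
      show 1 + D * u * (x ^ 2 * (1 / 2)) = 1 + D * u * (x ^ 2 / 2) by ring,
      show 1 - x * (1 / 2) = 1 - x / 2 by ring]
    generalize 1 + 2 * (D * u) * x ^ 2 = A at *
    generalize 1 + n * u * x = B at *
    generalize 1 + D * u * (x ^ 2 / 2) = C at *
    have h5 := h1.ne'
    generalize 1 - x / 2 = E at *
    field_simp
    ring
  have e2 : (D * u - m * u) * (x ^ 2 / 2) / ((1 + D * u * x ^ 2) * (1 + m * u * (x ^ 2 / 2))) / 2 =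
      u * (x ^ 2 / 4) * (D - m) / ((1 + D * u * x ^ 2) * (1 + m * u * (x ^ 2 / 2))) := by ring
  rw [e1, e2, div_le_div_iff₀ (by positivity) (by positivity)]
  have := mul_le_mul_of_nonneg_left h (show 0 ≤ u * (x ^ 2 / 4) by positivity)
  linarith

/-- The Hankel matrices of the moments of the Schur product of the two shifts are positive
semidefinite. -/
theorem hadamard_qHankel_half_posSemidef {s δ k : ℕ} (hδ : 1 ≤ δ) (hk : 1 ≤ k)
    (h : k = 1 ∨ (2 : ℝ) ^ (k - 1) * (2 * δ + 1) ≤ 2 * (s + 1)) {u : ℝ} (hu : 0 ≤ u) :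
    (qHankel (1 / 2) ((2 * δ + 1) * u) ((2 * δ + s + 1) * u) k ⊙
      qHankel (1 / 2) ((δ + 1) * u) ((2 * δ + s + 1) * u) k).PosSemidef := by
  have hδ' : (1 : ℝ) ≤ δ := by exact_mod_cast hδ
  have hs : (0 : ℝ) ≤ s := s.cast_nonneg
  have hle : ((δ : ℝ) + 1) * u ≤ (2 * δ + 1) * u := by gcongr; linarith
  rcases h with rfl | h
  · refine PosSemidef.hadamard (qHankel_posSemidef (by norm_num) (by norm_num) (by positivity)
      (by positivity) fun r hr => ?_) (qHankel_posSemidef (by norm_num) (by norm_num)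
      (by positivity) (by positivity) fun r hr => ?_) <;>
    · obtain rfl : r = 0 := by omega
      rw [pow_zero, mul_one]
      gcongr
      linarith
  obtain ⟨K, rfl⟩ := Nat.exists_eq_add_of_le' hk
  rw [Nat.add_sub_cancel] at h
  set x : ℝ := (1 / 2) ^ K with hx
  have hx0 : 0 < x := by positivity
  have hxK : x * 2 ^ K = 1 := by rw [hx, ← mul_pow]; norm_num
  have hx2 : 2 * δ + 1 ≤ 2 * x * (s + 1 : ℝ) := by
    have := mul_le_mul_of_nonneg_left h hx0.le
    rw [← mul_assoc, hxK] at this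
    linarith
  -- The assumption covers the ratios with `r ≤ K - 1` only; `r = K` is where the sign may fail.
  have hcond : ∀ r < K, (2 * δ + 1) * u ≤ (2 * δ + s + 1) * u * (1 / 2) ^ r := by
    intro r hr
    have h1 : 2 * x ≤ (1 / 2) ^ r := by
      obtain ⟨m, rfl⟩ := Nat.exists_eq_add_of_lt hr
      rw [hx, pow_succ, pow_add]
      have : ((1 : ℝ) / 2) ^ m ≤ 1 := pow_le_one₀ (by norm_num) (by norm_num)
      have : ((1 : ℝ) / 2) ^ r * (1 / 2) ^ m ≤ (1 / 2) ^ r * 1 := by gcongr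
      linarith
    calc (2 * δ + 1) * u ≤ 2 * x * (s + 1 : ℝ) * u := by gcongr
      _ ≤ (1 / 2) ^ r * (2 * δ + s + 1) * u := by gcongr; linarith
      _ = _ := by ring
  rcases Nat.eq_zero_or_pos K with rfl | hK
  · refine PosSemidef.hadamard (qHankel_posSemidef (by norm_num) (by norm_num) (by positivity)
      (by positivity) fun r hr => ?_) (qHankel_posSemidef (by norm_num) (by norm_num)
      (by positivity) (by positivity) fun r hr => ?_) <;>
    · obtain rfl : r = 0 := by omega
      rw [pow_zero, mul_one]
      gcongr
      linarith
  have hx3 : x = 1 / 2 ∨ x ≤ 1 / 4 := by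
    rcases Nat.lt_or_ge 1 K with h1 | h1
    · right
      calc x ≤ (1 / 2) ^ 2 := pow_le_pow_of_le_one (by norm_num) (by norm_num) h1
        _ = 1 / 4 := by norm_num
    · left
      obtain rfl : K = 1 := by omega
      rw [hx, pow_one]
  have hD : (2 * δ + 1 : ℝ) * (1 + 2 * x) - 2 * x ≤ 2 * x * (2 * δ + s + 1) := by linarith
  have hgap : ∀ n : ℝ, 0 ≤ n → n ≤ 2 * δ + s + 1 →
      0 ≤ qGap (1 / 2) (n * u) ((2 * δ + s + 1) * u) K := by
    intro n hn hn'
    rw [qGap_half (by positivity) (by positivity), ← sub_mul]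
    have := sub_nonneg.2 hn'
    positivity
  exact hadamard_qHankel_posSemidef (by norm_num) (by norm_num) (by positivity) (by positivity)
    (by positivity) (hgap _ (by positivity) (by linarith)) (hgap _ (by positivity) (by linarith))
    hcond (fun r hr => hle.trans (hcond r hr))
    (qRatio_half_le (by positivity) (by positivity) (by positivity) hu
      (pivot_ratio_bound_left (by linarith) (by ring) hu hx0 hx3 hD))
    (qRatio_half_le (by positivity) (by positivity) (by positivity) hu
      (pivot_ratio_bound_right (by linarith) (by ring) hu hx0 hx3 hD))

end HalfHankel

/-! ### From Hankel positivity to `k`-hyponormal weighted shifts. -/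

section ShiftCriterion

open Finset

theorem re_form_nonneg {ι : Type*} [Fintype ι] {M : Matrix ι ι ℝ} (hM : M.PosSemidef)
    (ξ : ι → ℂ) : 0 ≤ (∑ i, ∑ j, conj (ξ i) * ξ j * (M i j : ℂ)).re := by
  have h : ∀ v : ι → ℝ, 0 ≤ ∑ i, ∑ j, v i * v j * M i j := by
    intro v
    have := hM.dotProduct_mulVec_nonneg v
    simp only [dotProduct, Matrix.mulVec, star_trivial, mul_sum] at this
    refine this.trans_eq (sum_congr rfl fun i _ => sum_congr rfl fun j _ => by ring)
  have h1 := add_nonneg (h fun i => (ξ i).re) (h fun i => (ξ i).im)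
  refine h1.trans_eq ?_
  simp only [Complex.re_sum, ← sum_add_distrib]
  refine sum_congr rfl fun i _ => sum_congr rfl fun j _ => ?_
  simp
  ring

theorem sum_range_shift {g : ℕ → ℂ} {P : ℕ} (hg : ∀ i < P, g i = 0) (n : ℕ) :
    ∑ i ∈ range n, g i = ∑ i ∈ range n, if i + P < n then g (i + P) else 0 := by
  rw [← sum_filter]
  symm
  refine sum_bij_ne_zero (fun i _ _ => i + P) (fun i hi _ => ?_) (fun i _ _ j _ _ h => ?_)
    (fun i hi h => ?_) (fun i _ _ => rfl)
  · exact mem_range.2 (mem_filter.1 hi).2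
  · exact Nat.add_right_cancel h
  · have hP : P ≤ i := not_lt.1 fun hlt => h (hg i hlt)
    have hi' := mem_range.1 hi
    refine ⟨i - P, mem_filter.2 ⟨mem_range.2 (by omega), by omega⟩, ?_, by omega⟩
    rwa [Nat.sub_add_cancel hP]

theorem sum_sum_range_shift {f : ℕ → ℕ → ℂ} {P : ℕ} (hf : ∀ i < P, ∀ j, f i j = 0)
    (hf' : ∀ i, ∀ j < P, f i j = 0) (n : ℕ) :
    ∑ i ∈ range n, ∑ j ∈ range n, f i j = ∑ i ∈ range n, ∑ j ∈ range n,
      if i + P < n ∧ j + P < n then f (i + P) (j + P) else 0 := by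
  rw [sum_range_shift (fun i hi => sum_eq_zero fun j _ => hf i hi j)]
  refine sum_congr rfl fun i _ => ?_
  by_cases hi : i + P < n
  · simp only [hi, if_true, true_and]
    exact sum_range_shift (fun j hj => hf' _ j hj) n
  · simp [hi]

/-- The coordinates of a vector relative to the products of the weights, extended by zero to the
negative integers. -/
noncomputable def scaledCoord (α : ℕ → ℝ) (x : ℕ → ℂ) (m : ℤ) : ℂ :=
  if 0 ≤ m then x m.toNat / ((∏ l ∈ range m.toNat, α l : ℝ) : ℂ) else 0

theorem weightedShift_pow_apply {α : ℕ → ℝ} (hα : BddAbove (Set.range fun n => |α n|))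
    (hpos : ∀ n, 0 < α n) (j : ℕ) (x : lp (fun _ : ℕ => ℂ) 2) (n : ℕ) :
    ((weightedShift α hα ^ j) x) n =
      ((∏ l ∈ range n, α l : ℝ) : ℂ) * scaledCoord α x ((n : ℤ) - j) := by
  induction j generalizing n with
  | zero =>
    have : ((∏ l ∈ range n, α l : ℝ) : ℂ) ≠ 0 := by
      exact_mod_cast (prod_pos fun l _ => hpos l).ne'
    simp only [scaledCoord, pow_zero, one_apply_eq_self, Nat.cast_zero, sub_zero,
      Nat.cast_nonneg, if_true, Int.toNat_natCast]
    rw [mul_div_cancel₀ _ this]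
  | succ j ih =>
    rw [pow_succ']
    change weightedShift α hα ((weightedShift α hα ^ j) x) n = _
    rw [weightedShift_apply]
    cases n with
    | zero =>
      rw [scaledCoord, if_neg (by push_cast; omega), mul_zero]
      rfl
    | succ n =>
      rw [shiftSeq, ih, prod_range_succ, show ((n + 1 : ℕ) : ℤ) - (j + 1 : ℕ) = (n : ℤ) - j by
        push_cast; ring]
      push_cast
      ring

/-- A weighted shift is `k`-hyponormal if the Hankel matrices of size `k + 1` of its moments are
positive semidefinite. -/
theorem isKHyponormal_weightedShift {α : ℕ → ℝ} (hα : BddAbove (Set.range fun n => |α n|))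
    (hpos : ∀ n, 0 < α n) {k : ℕ}
    (h : ∀ n, (Matrix.of fun i j : Fin (k + 1) =>
      ∏ l ∈ range ((i : ℕ) + j), α (n + l) ^ 2).PosSemidef) :
    IsKHyponormal k (weightedShift α hα) := by
  intro x
  set T := weightedShift α hα with hT
  set Γ : ℕ → ℝ := fun n => ∏ l ∈ range n, α l with hΓ
  set Y : Fin (k + 1) → ℤ → ℂ := fun i => scaledCoord α (x i) with hY
  have hYneg : ∀ i m, m < 0 → Y i m = 0 := fun i m hm => if_neg (not_le.2 hm)
  -- The entry is `⟪T^j x_i, T^i x_j⟫`, a sum over coordinates `m`. Substituting `m = p + i + j`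
  -- makes the vector factors depend on `i` and `j` separately and the weight on `i + j`, so each
  -- `p` gives a Hankel form. Extension by zero lets `p` run over all integers.
  have hterm : ∀ i j : Fin (k + 1), HasSum (fun p : ℤ => conj (Y i (p + i)) * Y j (p + j) *
      ((Γ (p + i + j).toNat : ℂ)) ^ 2)
      ⟪x i, ((ContinuousLinearMap.adjoint T) ^ (j : ℕ)) ((T ^ (i : ℕ)) (x j))⟫_ℂ := by
    intro i j
    rw [← ContinuousLinearMap.star_eq_adjoint, ← star_pow, ContinuousLinearMap.star_eq_adjoint,
      ContinuousLinearMap.adjoint_inner_right]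
    have h1 := lp.hasSum_inner (𝕜 := ℂ) ((T ^ (j : ℕ)) (x i)) ((T ^ (i : ℕ)) (x j))
    set G : ℤ → ℂ := fun m => conj (Y i (m - j)) * Y j (m - i) * (Γ m.toNat : ℂ) ^ 2 with hG
    have h2 : (fun n : ℕ => ⟪((T ^ (j : ℕ)) (x i)) n, ((T ^ (i : ℕ)) (x j)) n⟫_ℂ) =
        G ∘ ((↑) : ℕ → ℤ) := by
      ext n
      rw [hT, weightedShift_pow_apply hα hpos, weightedShift_pow_apply hα hpos]
      simp only [RCLike.inner_apply, map_mul, Complex.conj_ofReal, Function.comp_apply, hG,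
        Int.toNat_natCast, hΓ, hY]
      ring
    rw [h2] at h1
    have h3 : HasSum G _ := (Nat.cast_injective.hasSum_iff (fun m hm => by
      have : m < 0 := by
        by_contra hge
        exact hm ⟨m.toNat, by simp [not_lt.1 hge]⟩
      simp only [hG]
      rw [hYneg i (m - j) (by omega)]
      simp)).1 h1
    have h4 := (Equiv.hasSum_iff (Equiv.addRight ((i : ℤ) + j))).2 h3
    refine h4.congr_fun ?_ |> fun h => h
    intro p
    simp only [Function.comp_apply, Equiv.coe_addRight, hG]
    rw [show p + ((i : ℤ) + j) - j = p + i by ring, show p + ((i : ℤ) + j) - i = p + j by ring,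
      ← add_assoc]
  have hsum := hasSum_sum (s := univ) fun i _ => hasSum_sum (s := univ) fun j _ => hterm i j
  refine (Complex.hasSum_re hsum).nonneg fun p => ?_
  rcases le_or_gt 0 p with hp | hp
  · obtain ⟨n, rfl⟩ := Int.eq_ofNat_of_zero_le hp
    have h1 := re_form_nonneg (h n) fun i => (Γ n : ℂ) * Y i (n + i)
    refine h1.trans_eq (congrArg _ (sum_congr rfl fun i _ => sum_congr rfl fun j _ => ?_))
    rw [show ((n : ℤ) + i + j).toNat = n + ((i : ℕ) + j) by omega]
    simp only [hΓ, Matrix.of_apply, prod_range_add, map_mul, Complex.conj_ofReal, prod_pow]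
    push_cast
    ring
  -- For `p = -P` the coordinates with `i < P` vanish. Shifting `i` and `j` by `P` gives moment
  -- index `P + i + j`, hence the Hankel form starting at `P`, on a vector padded with zeros.
  · obtain ⟨P, rfl⟩ : ∃ P : ℕ, p = -P := ⟨(-p).toNat, by omega⟩
    set η : ℕ → ℂ := fun i => if hi : i < k + 1 then Y ⟨i, hi⟩ (-P + i) else 0 with hη
    have hη0 : ∀ i < P, η i = 0 := by
      intro i hi
      simp only [hη]
      split_ifs with h1
      · exact hYneg _ _ (by omega)
      · rfl
    have h1 := re_form_nonneg (h P) fun i =>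
      (Γ P : ℂ) * (if (i : ℕ) + P < k + 1 then η (i + P) else 0)
    refine h1.trans_eq (congrArg _ ?_)
    set f : ℕ → ℕ → ℂ := fun i j => conj (η i) * η j * (Γ (-(P : ℤ) + i + j).toNat : ℂ) ^ 2 with hf
    have h2 : ∑ i : Fin (k + 1), ∑ j : Fin (k + 1), conj (Y i (-P + i)) * Y j (-P + j) *
        ((Γ (-(P : ℤ) + i + j).toNat : ℂ)) ^ 2 = ∑ i ∈ range (k + 1), ∑ j ∈ range (k + 1), f i j := by
      rw [← Fin.sum_univ_eq_sum_range (fun i => ∑ j ∈ range (k + 1), f i j)]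
      refine sum_congr rfl fun i _ => ?_
      rw [← Fin.sum_univ_eq_sum_range]
      refine sum_congr rfl fun j _ => ?_
      simp [hf, hη, Fin.is_le]
    rw [h2, sum_sum_range_shift (P := P) (fun i hi j => by simp [hf, hη0 i hi])
      (fun i j hj => by simp [hf, hη0 j hj]),
      ← Fin.sum_univ_eq_sum_range (fun i => ∑ j ∈ range (k + 1),
        if i + P < k + 1 ∧ j + P < k + 1 then f (i + P) (j + P) else 0)]
    refine sum_congr rfl fun i _ => ?_
    rw [← Fin.sum_univ_eq_sum_range (fun j =>
        if (i : ℕ) + P < k + 1 ∧ j + P < k + 1 then f (i + P) (j + P) else 0)]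
    refine sum_congr rfl fun j _ => ?_
    by_cases hi : (i : ℕ) + P < k + 1
    · by_cases hj : (j : ℕ) + P < k + 1
      · simp only [hi, hj, if_true, and_self, hf]
        rw [show (-(P : ℤ) + ((i : ℕ) + P : ℕ) + ((j : ℕ) + P : ℕ)).toNat = P + ((i : ℕ) + j) by
          omega]
        simp only [hΓ, Matrix.of_apply, prod_range_add, map_mul, Complex.conj_ofReal, prod_pow]
        push_cast
        ring
      · simp [hj]
    · simp [hi]

theorem schurWeight_pos (s δ : ℕ) (j : founders δ) (n : ℕ) :
    0 < weight₁ s δ j n * weight₂ s δ j n := by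
  have hj : (0 : ℝ) < (j : ℕ) - 2 * δ := by
    have : ((2 * δ + 1 : ℕ) : ℝ) ≤ (j : ℕ) := by exact_mod_cast j.2.1
    push_cast at this
    linarith
  unfold weight₁ weight₂ grwsWeight
  positivity

theorem schurWeight_sq (s δ : ℕ) (j : founders δ) (n l : ℕ) :
    (weight₁ s δ j (n + l) * weight₂ s δ j (n + l)) ^ 2 =
      (1 + (2 * δ + 1) * (2 ^ n * ((j : ℕ) - 2 * δ : ℝ))⁻¹ * (1 / 2) ^ l) /
        (1 + (2 * δ + s + 1) * (2 ^ n * ((j : ℕ) - 2 * δ : ℝ))⁻¹ * (1 / 2) ^ l) *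
      ((1 + (δ + 1) * (2 ^ n * ((j : ℕ) - 2 * δ : ℝ))⁻¹ * (1 / 2) ^ l) /
        (1 + (2 * δ + s + 1) * (2 ^ n * ((j : ℕ) - 2 * δ : ℝ))⁻¹ * (1 / 2) ^ l)) := by
  have hj : (0 : ℝ) < (j : ℕ) - 2 * δ := by
    have : ((2 * δ + 1 : ℕ) : ℝ) ≤ (j : ℕ) := by exact_mod_cast j.2.1
    push_cast at this
    linarith
  have key : ∀ N D : ℝ, 0 ≤ N → 0 ≤ D →
      grwsWeight 2 (N / ((j : ℕ) - 2 * δ)) (D / ((j : ℕ) - 2 * δ)) (n + l) ^ 2 =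
        (1 + N * (2 ^ n * ((j : ℕ) - 2 * δ : ℝ))⁻¹ * (1 / 2) ^ l) /
          (1 + D * (2 ^ n * ((j : ℕ) - 2 * δ : ℝ))⁻¹ * (1 / 2) ^ l) := by
    intro N D hN hD
    generalize ((j : ℕ) : ℝ) - 2 * δ = c at *
    -- Dividing numerator and denominator by `2^(n+l)` turns base `2` into `q = 1/2` and puts the
    -- starting index `n` into the parameter `u`.
    rw [grwsWeight, Real.sq_sqrt (by positivity), pow_add, one_div, inv_pow,
      div_eq_div_iff (by positivity) (by positivity)]
    field_simp
  rw [mul_pow, weight₁, weight₂, key _ _ (by positivity) (by positivity),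
    key _ _ (by positivity) (by positivity)]

theorem isKHyponormal_schurShift {s δ k : ℕ} (hδ : 1 ≤ δ) (hk : 1 ≤ k)
    (h : k = 1 ∨ (2 : ℝ) ^ (k - 1) * (2 * δ + 1) ≤ 2 * (s + 1)) (j : founders δ) :
    IsKHyponormal k (schurShift s δ j) := by
  have hj : (0 : ℝ) < (j : ℕ) - 2 * δ := by
    have : ((2 * δ + 1 : ℕ) : ℝ) ≤ (j : ℕ) := by exact_mod_cast j.2.1
    push_cast at this
    linarith
  refine isKHyponormal_weightedShift _ (schurWeight_pos s δ j) fun n => ?_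
  have := hadamard_qHankel_half_posSemidef (s := s) hδ hk h
    (u := (2 ^ n * ((j : ℕ) - 2 * δ : ℝ))⁻¹) (by positivity)
  convert this using 1
  ext i m
  simp only [Matrix.of_apply, Matrix.hadamard_apply, qHankel, qMoment, qRise, schurWeight_sq,
    prod_mul_distrib, prod_div_distrib]

/-- The threshold of the theorem implies the bound needed for `k`-hyponormality. -/
theorem threshold_le {s δ k : ℕ} (hk : 1 ≤ k)
    (h : min ((2 : ℝ) ^ ((k : ℤ) - 1) * (2 * δ + 1))
      ((2 : ℝ) ^ ((k : ℤ) - 2) * (2 * δ - 1) + (2 : ℝ) ^ ((k : ℤ) - 1) - 1) ≤ (s : ℝ)) :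
    (2 : ℝ) ^ (k - 1) * (2 * δ + 1) ≤ 2 * (s + 1) := by
  obtain ⟨K, rfl⟩ := Nat.exists_eq_add_of_le' hk
  have h1 : (2 : ℝ) ^ (((K + 1 : ℕ) : ℤ) - 1) = 2 ^ K := by
    rw [show ((K + 1 : ℕ) : ℤ) - 1 = (K : ℤ) by push_cast; ring, zpow_natCast]
  have h2 : (2 : ℝ) ^ (((K + 1 : ℕ) : ℤ) - 2) = 2 ^ K / 2 := by
    rw [show ((K + 1 : ℕ) : ℤ) - 2 = (K : ℤ) - 1 by push_cast; ring,
      zpow_sub_one₀ (by norm_num), zpow_natCast, div_eq_mul_inv]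
  rw [h1, h2] at h
  rw [Nat.add_sub_cancel]
  have h3 : (0 : ℝ) < 2 ^ K := by positivity
  have h4 : (0 : ℝ) ≤ 2 ^ K * (2 * δ + 1) := by positivity
  rcases min_le_iff.1 h with h | h <;> linarith

end ShiftCriterion

/-! ### Completeness of the monomials in the Bergman space. -/

section Completeness

theorem monotone_integral_limit {h : ℂ → ℂ} (hh : IntegrableOn h (Metric.ball (0 : ℂ) 1)) :
    Tendsto (fun k : ℕ => ∫ z in Metric.ball (0 : ℂ) (1 - 1 / ((k : ℝ) + 2)), h z) atTop
      (𝓝 (∫ z in Metric.ball (0 : ℂ) 1, h z)) := by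
  have hU : (⋃ k : ℕ, Metric.ball (0 : ℂ) (1 - 1 / ((k : ℝ) + 2))) = Metric.ball (0 : ℂ) 1 := by
    ext z
    simp only [Set.mem_iUnion, mem_ball_zero_iff]
    constructor
    · rintro ⟨k, hk⟩
      have : (0 : ℝ) < 1 / ((k : ℝ) + 2) := by positivity
      linarith
    · intro hz
      obtain ⟨k, hk⟩ := exists_nat_one_div_lt (sub_pos.2 hz)
      refine ⟨k, ?_⟩
      have : 1 / ((k : ℝ) + 2) ≤ 1 / ((k : ℝ) + 1) := by gcongr; norm_num
      linarith
  rw [← hU] at hh ⊢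
  refine tendsto_setIntegral_of_monotone₀ (fun k => measurableSet_ball.nullMeasurableSet) ?_ hh
  intro k l hkl
  refine Metric.ball_subset_ball ?_
  have : (k : ℝ) ≤ l := by exact_mod_cast hkl
  gcongr

/-- On the circle of radius `ρ` the integrand is `ρ^(2n) G`, so the mean value property applies. It
needs `r < 1`, since `G` is controlled only inside the disk; the full disk is reached by exhaustion.
-/
theorem integral_ball_pow_mul {G : ℂ → ℂ} (hG : DifferentiableOn ℂ G (Metric.ball (0 : ℂ) 1))
    (n : ℕ) {r : ℝ} (hr : 0 ≤ r) (hr1 : r < 1) :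
    ∫ z in Metric.ball (0 : ℂ) r, z ^ n * G z * conj z ^ n =
      ((Real.pi * r ^ (2 * n + 2) / (n + 1) : ℝ) : ℂ) * G 0 := by
  have hsub : Metric.closedBall (0 : ℂ) r ⊆ Metric.ball (0 : ℂ) 1 :=
    Metric.closedBall_subset_ball hr1
  rw [integral_ball_eq_circleAverage]
  · have h2 : ∀ ρ ∈ Set.Ioo (0 : ℝ) r, (ρ * (2 * Real.pi)) •
        Real.circleAverage (fun z : ℂ => z ^ n * G z * conj z ^ n) 0 ρ =
        ((ρ ^ (2 * n + 1) : ℝ) : ℂ) * (2 * Real.pi * G 0) := by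
      intro ρ hρ
      have h1 : Real.circleAverage (fun z : ℂ => z ^ n * G z * conj z ^ n) 0 ρ =
          Real.circleAverage (fun z : ℂ => (ρ : ℂ) ^ (2 * n) * G z) 0 ρ := by
        refine Real.circleAverage_congr_sphere fun z hz => ?_
        have hz' : ‖z‖ = ρ := by simpa [abs_of_pos hρ.1] using hz
        have h2 : z * conj z = (ρ : ℂ) ^ 2 := by
          rw [Complex.mul_conj, Complex.normSq_eq_norm_sq, hz']; push_cast; rfl
        change z ^ n * G z * conj z ^ n = (ρ : ℂ) ^ (2 * n) * G z
        rw [pow_mul, ← h2]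
        ring
      rw [h1, DiffContOnCl.circleAverage, Complex.real_smul]
      · push_cast
        ring
      · rw [abs_of_pos hρ.1]
        refine ((hG.const_mul _).mono ?_).diffContOnCl_ball subset_rfl
        exact (Metric.closedBall_subset_closedBall hρ.2.le).trans hsub
    rw [setIntegral_congr_fun measurableSet_Ioo h2, integral_mul_const, integral_complex_ofReal,
      ← integral_Ioc_eq_integral_Ioo, ← intervalIntegral.integral_of_le hr, integral_pow]
    have hn : (n : ℂ) + 1 ≠ 0 := by exact_mod_cast n.succ_ne_zero
    have hn2 : (2 * n + 1 + 1 : ℂ) = 2 * (n + 1) := by ring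
    push_cast
    rw [hn2]
    field_simp
    simp
  · have := hG.continuousOn.mono hsub
    fun_prop

theorem apply_zero_of_inner_eq_zero {f : Lp ℂ 2 diskMeasure} {G : ℂ → ℂ} {n : ℕ}
    (hG : DifferentiableOn ℂ G (Metric.ball (0 : ℂ) 1))
    (hf : f =ᵐ[diskMeasure] fun z => z ^ n * G z) (h : ⟪monomial 2 n 0, f⟫_ℂ = 0) : G 0 = 0 := by
  have hae : (fun z => ⟪monomial 2 n 0 z, f z⟫_ℂ) =ᵐ[diskMeasure]
      fun z => z ^ n * G z * conj z ^ n := by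
    filter_upwards [(memLp_monomial 2 n 0).coeFn_toLp, hf] with z h1 h2
    rw [monomial, h1, h2, RCLike.inner_apply]
    simp
  have hint : Integrable (fun z => z ^ n * G z * conj z ^ n) diskMeasure :=
    (L2.integrable_inner (𝕜 := ℂ) (monomial 2 n 0) f).congr hae
  have hint' : IntegrableOn (fun z => z ^ n * G z * conj z ^ n) (Metric.ball (0 : ℂ) 1) := by
    rw [diskMeasure, integrable_smul_measure (by simp) (by simp [Real.pi_pos])] at hint
    exact hint
  rw [L2.inner_def, integral_congr_ae hae, integral_diskMeasure] at h
  have h0 : ∫ z in Metric.ball (0 : ℂ) 1, z ^ n * G z * conj z ^ n = 0 := by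
    refine (mul_eq_zero.1 h).resolve_left (inv_ne_zero ?_)
    exact_mod_cast Real.pi_ne_zero
  have hlim := monotone_integral_limit hint'
  rw [h0] at hlim
  have hr : ∀ k : ℕ, 0 ≤ 1 - 1 / ((k : ℝ) + 2) ∧ 1 - 1 / ((k : ℝ) + 2) < 1 := by
    intro k
    have h1 : (0 : ℝ) < 1 / ((k : ℝ) + 2) := by positivity
    have h2 : 1 / ((k : ℝ) + 2) ≤ 1 := by
      rw [div_le_one (by positivity)]
      linarith [(Nat.cast_nonneg k : (0 : ℝ) ≤ k)]
    constructor <;> linarith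
  simp only [fun k : ℕ => integral_ball_pow_mul hG n (hr k).1 (hr k).2] at hlim
  have hlim' : Tendsto (fun k : ℕ => ((Real.pi * (1 - 1 / ((k : ℝ) + 2)) ^ (2 * n + 2) / (n + 1) : ℝ)
      : ℂ) * G 0) atTop (𝓝 (((Real.pi * (1 - 0) ^ (2 * n + 2) / (n + 1) : ℝ) : ℂ) * G 0)) := by
    refine Tendsto.mul_const _ ?_
    refine (Complex.continuous_ofReal.tendsto _).comp ?_
    have h3 : Tendsto (fun k : ℕ => 1 / ((k : ℝ) + 2)) atTop (𝓝 0) := by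
      simpa [add_assoc, one_add_one_eq_two] using
        (tendsto_add_atTop_iff_nat (f := fun k : ℕ => 1 / ((k : ℝ) + 1)) 1).2
          tendsto_one_div_add_atTop_nhds_zero_nat
    exact (((h3.const_sub 1).pow _).const_mul _).div_const _
  have h4 := tendsto_nhds_unique hlim hlim'
  refine (mul_eq_zero.1 h4.symm).resolve_left ?_
  refine Complex.ofReal_ne_zero.2 ?_
  rw [sub_zero, one_pow]
  positivity

/-- If the analytic representative is `z^n G`, orthogonality to `z^n` forces `G 0 = 0`, so another
factor `z` splits off. A zero of infinite order at `0` makes the function vanish identically. -/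
theorem eq_zero_of_inner_monomial_eq_zero {f : Lp ℂ 2 diskMeasure} (hf : f ∈ bergman)
    (h : ∀ n, ⟪monomial 2 n 0, f⟫_ℂ = 0) : f = 0 := by
  obtain ⟨F, hF, hfF⟩ := hf
  have hfac : ∀ n : ℕ, ∃ G : ℂ → ℂ, DifferentiableOn ℂ G (Metric.ball (0 : ℂ) 1) ∧
      ∀ z, F z = z ^ n * G z := by
    intro n
    induction n with
    | zero => exact ⟨F, hF, fun z => by simp⟩
    | succ n ih =>
      obtain ⟨G, hG, hFG⟩ := ih
      have h0 := apply_zero_of_inner_eq_zero hG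
        (hfF.trans (Eventually.of_forall hFG)) (h n)
      refine ⟨dslope G 0, (Complex.differentiableOn_dslope
        (Metric.ball_mem_nhds _ one_pos)).2 hG, fun z => ?_⟩
      have := sub_smul_dslope G 0 z
      rw [h0, sub_zero, sub_zero, smul_eq_mul] at this
      rw [hFG, pow_succ, mul_assoc, this]
  have hana : AnalyticOnNhd ℂ F (Metric.ball (0 : ℂ) 1) := hF.analyticOnNhd Metric.isOpen_ball
  have hloc : ∀ᶠ z in 𝓝 (0 : ℂ), F z = 0 := by
    by_contra hne
    obtain ⟨n, g, hg, hg0, hev⟩ := ((hana 0 (Metric.mem_ball_self one_pos)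
      ).exists_eventuallyEq_pow_smul_nonzero_iff).2 hne
    obtain ⟨G, hG, hFG⟩ := hfac (n + 1)
    have hGc : ContinuousAt G 0 :=
      (hG.differentiableAt (Metric.ball_mem_nhds _ one_pos)).continuousAt
    have h1 : ∀ᶠ z in 𝓝[≠] (0 : ℂ), g z = z * G z := by
      filter_upwards [nhdsWithin_le_nhds hev, self_mem_nhdsWithin] with z hz hz0
      have hz0' : z ≠ 0 := hz0
      rw [hFG, sub_zero, smul_eq_mul, pow_succ, mul_assoc] at hz
      exact (mul_left_cancel₀ (pow_ne_zero n hz0') hz).symm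
    have h2 : Tendsto g (𝓝[≠] (0 : ℂ)) (𝓝 (g 0)) := hg.continuousAt.tendsto.mono_left
      nhdsWithin_le_nhds
    have h3 : Tendsto (fun z => z * G z) (𝓝[≠] (0 : ℂ)) (𝓝 (0 * G 0)) :=
      (continuousAt_id.mul hGc).tendsto.mono_left nhdsWithin_le_nhds
    have h4 := tendsto_nhds_unique (h2.congr' h1) h3
    rw [zero_mul] at h4
    exact hg0 h4
  have hzero := hana.eqOn_zero_of_preconnected_of_eventuallyEq_zero
    (convex_ball (0 : ℂ) 1).isPreconnected (Metric.mem_ball_self one_pos) hloc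
  rw [Lp.eq_zero_iff_ae_eq_zero]
  filter_upwards [hfF, ae_diskMeasure_mem_ball] with z hz hzb
  rw [hz]
  exact hzero hzb

theorem basisVec_orthogonal_eq_bot : (Submodule.span ℂ (Set.range basisVec))ᗮ = ⊥ := by
  rw [Submodule.eq_bot_iff]
  intro f hf
  have h : ∀ n, ⟪monomial 2 n 0, (f : Lp ℂ 2 diskMeasure)⟫_ℂ = 0 := by
    intro n
    have h1 := (Submodule.mem_orthogonal _ _).1 hf (basisVec n)
      (Submodule.subset_span ⟨n, rfl⟩)
    rw [basisVec, Submodule.coe_inner, Submodule.coe_smul, inner_smul_left] at h1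
    refine (mul_eq_zero.1 h1).resolve_left ?_
    rw [Complex.conj_ofReal]
    have : √((n : ℝ) + 1) ≠ 0 := by positivity
    exact_mod_cast this
  exact Subtype.ext (eq_zero_of_inner_monomial_eq_zero f.2 h)

/-- The vectors `basisVec n` as a Hilbert basis of the Bergman space. -/
noncomputable def bergmanBasis : HilbertBasis ℕ ℂ bergman :=
  HilbertBasis.mkOfOrthogonalEqBot orthonormal_basisVec basisVec_orthogonal_eq_bot

theorem bergmanBasis_apply (n : ℕ) : bergmanBasis n = basisVec n :=
  congrFun (HilbertBasis.coe_mkOfOrthogonalEqBot orthonormal_basisVec basisVec_orthogonal_eq_bot) n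

theorem ext_inner_basisVec {f g : bergman}
    (h : ∀ n, ⟪basisVec n, f⟫_ℂ = ⟪basisVec n, g⟫_ℂ) : f = g := by
  refine bergmanBasis.repr.injective (lp.ext (funext fun n => ?_))
  rw [HilbertBasis.repr_apply_apply, HilbertBasis.repr_apply_apply, bergmanBasis_apply, h]

end Completeness

/-! ### Action of `B*` on the basis, and the norm bound. -/

section Action

theorem mulOp_monomial (t s p q : ℕ) :
    mulOp (monomial ∞ t s) (monomial 2 p q) = monomial 2 (t + p) (s + q) := by
  refine Lp.ext ?_
  refine ((ContinuousLinearMap.mul ℂ ℂ).coeFn_holder (monomial ∞ t s) (monomial 2 p q)).trans ?_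
  filter_upwards [(memLp_monomial ∞ t s).coeFn_toLp, (memLp_monomial 2 p q).coeFn_toLp,
    (memLp_monomial 2 (t + p) (s + q)).coeFn_toLp] with z h1 h2 h3
  rw [monomial, monomial, monomial, h1, h2, h3, ContinuousLinearMap.mul_apply']
  ring

/-- The index `σ m` such that `B* e_m` is a multiple of `e_{σ m}`. -/
def hIndex (δ m : ℕ) : ℕ := if m < δ then 2 * (δ - 1 - m) + 1 else 2 * (m - δ)

/-- The weight `w_m` such that `B* e_m = w_m e_{σ m}`. -/
noncomputable def hWeight (s δ m : ℕ) : ℝ :=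
  if m < δ then √(m + 1) * √(δ - m + 1) / (s + δ + 1) else √(m + 1) * √(m - δ + 1) / (m + s + 1)

theorem hIndex_injective (δ : ℕ) : Function.Injective (hIndex δ) := by
  intro m n h
  unfold hIndex at h
  split_ifs at h <;> omega

theorem inner_basisVec_hToeplitz {s δ : ℕ} (m n : ℕ) :
    ⟪basisVec m, hToeplitz (monomial ∞ (s + δ) s) (basisVec n)⟫_ℂ =
      if n = hIndex δ m then (hWeight s δ m : ℂ) else 0 := by
  rw [hToeplitz, ContinuousLinearMap.comp_apply, ContinuousLinearMap.comp_apply, K_basisVec,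
    Submodule.inner_orthogonalProjectionOnto_eq_of_mem_left]
  simp only [basisVec, Submodule.coe_smul, inner_smul_left, Complex.conj_ofReal]
  rcases Nat.even_or_odd' n with ⟨p, rfl | rfl⟩
  -- Even `n = 2p`: the product is a multiple of `z^(s+δ+p) conj z^s`, which meets only `z^(p+δ)`.
  -- In the odd case `n = 2p + 1` the partner is `z^(δ-p-1)`, if that exponent is nonnegative.
  · rw [harmonicVec, if_pos (even_two_mul p), map_smul, mulOp_monomial, inner_smul_right,
      inner_monomial, Nat.mul_div_cancel_left _ two_pos]
    by_cases h : p + δ = m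
    · subst h
      rw [if_pos (by omega), if_pos (by simp [hIndex]), hWeight, if_neg (by omega)]
      push_cast
      rw [show ((p : ℝ) + δ - δ + 1) = p + 1 by ring]
      ring
    · rw [if_neg (by omega), if_neg (by unfold hIndex; split_ifs <;> omega)]
      simp
  · rw [harmonicVec, if_neg (by simp), map_smul, mulOp_monomial, inner_smul_right,
      inner_monomial, show (2 * p + 1) / 2 = p by omega]
    by_cases h : p + 1 + m = δ
    · subst h
      rw [if_pos (by omega), if_pos (by unfold hIndex; rw [if_pos (by omega)]; omega), hWeight,
        if_pos (by omega)]
      push_cast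
      rw [show ((p : ℝ) + 1 + m - m + 1) = p + 2 by ring]
      ring
    · rw [if_neg (by omega), if_neg (by unfold hIndex; split_ifs <;> omega)]
      simp

theorem adjoint_hToeplitz_basisVec (s δ m : ℕ) :
    ContinuousLinearMap.adjoint (hToeplitz (monomial ∞ (s + δ) s)) (basisVec m) =
      (hWeight s δ m : ℂ) • basisVec (hIndex δ m) := by
  refine ext_inner_basisVec fun n => ?_
  rw [ContinuousLinearMap.adjoint_inner_right, ← inner_conj_symm, inner_basisVec_hToeplitz]
  refine Eq.trans ?_ (inner_smul_right (basisVec n) (basisVec (hIndex δ m)) _).symm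
  rw [orthonormal_iff_ite.1 orthonormal_basisVec]
  split_ifs <;> simp

theorem norm_monomial_top_le (t s : ℕ) : ‖monomial ∞ t s‖ ≤ 1 := by
  have h : ∀ᵐ z ∂diskMeasure, ‖monomial ∞ t s z‖ ≤ 1 := by
    filter_upwards [ae_diskMeasure_mem_ball, (memLp_monomial ∞ t s).coeFn_toLp] with z hz h1
    rw [mem_ball_zero_iff] at hz
    rw [monomial, h1]
    simp only [norm_mul, norm_pow, RCLike.norm_conj]
    exact mul_le_one₀ (pow_le_one₀ (norm_nonneg _) hz.le) (by positivity)
      (pow_le_one₀ (norm_nonneg _) hz.le)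
  simpa using Lp.norm_le_of_ae_bound zero_le_one h

theorem norm_K_le : ‖K‖ ≤ 1 := by
  refine (ContinuousLinearMap.opNorm_comp_le _ _).trans ?_
  refine mul_le_one₀ (LinearIsometry.norm_toContinuousLinearMap_le _) (ContinuousLinearMap.opNorm_nonneg _) ?_
  rw [LinearIsometryEquiv.norm_map]
  exact LinearIsometry.norm_toContinuousLinearMap_le _

theorem norm_hToeplitz_monomial_le (t s : ℕ) : ‖hToeplitz (monomial ∞ t s)‖ ≤ 1 := by
  refine (ContinuousLinearMap.opNorm_comp_le _ _).trans ?_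
  refine mul_le_one₀ (Submodule.orthogonalProjectionOnto_norm_le _) (ContinuousLinearMap.opNorm_nonneg _) ?_
  refine (ContinuousLinearMap.opNorm_comp_le _ _).trans ?_
  refine mul_le_one₀ ?_ (ContinuousLinearMap.opNorm_nonneg _) norm_K_le
  refine ContinuousLinearMap.opNorm_le_bound _ zero_le_one fun f => ?_
  refine ((ContinuousLinearMap.mul ℂ ℂ).norm_holder_apply_apply_le (monomial ∞ t s) f).trans ?_
  gcongr
  exact mul_le_one₀ (ContinuousLinearMap.opNorm_mul_le ℂ ℂ) (norm_nonneg _)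
    (norm_monomial_top_le t s)

end Action

/-! ### Criteria for and against hyponormality. -/

section Hyponormality

theorem hasSum_norm_sq_inner {H : Type*} [NormedAddCommGroup H] [InnerProductSpace ℂ H]
    {ι : Type*} (b : HilbertBasis ι ℂ H) (x : H) :
    HasSum (fun i => ‖⟪b i, x⟫_ℂ‖ ^ 2) (‖x‖ ^ 2) := by
  have := lp.hasSum_norm (p := 2) (by norm_num) (b.repr x)
  simpa [HilbertBasis.repr_apply_apply] using this

variable {H : Type*} [NormedAddCommGroup H] [InnerProductSpace ℂ H] [CompleteSpace H]

theorem isHyponormal_iff {T : H →L[ℂ] H} :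
    IsHyponormal T ↔ ∀ x, ‖ContinuousLinearMap.adjoint T x‖ ≤ ‖T x‖ := by
  have key : ∀ x, ⟪(ContinuousLinearMap.adjoint T ∘L T - T ∘L ContinuousLinearMap.adjoint T) x,
      x⟫_ℂ = ((‖T x‖ ^ 2 - ‖ContinuousLinearMap.adjoint T x‖ ^ 2 : ℝ) : ℂ) := by
    intro x
    rw [sub_apply, ContinuousLinearMap.comp_apply, ContinuousLinearMap.comp_apply,
      inner_sub_left, ContinuousLinearMap.adjoint_inner_left,
      ← ContinuousLinearMap.adjoint_inner_right T _ x, inner_self_eq_norm_sq_to_K,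
      inner_self_eq_norm_sq_to_K]
    push_cast
    rfl
  rw [IsHyponormal, ContinuousLinearMap.isPositive_iff_complex]
  refine forall_congr' fun x => ?_
  rw [key, RCLike.re_to_complex, Complex.ofReal_re]
  simp only [true_and, sub_nonneg]
  exact pow_le_pow_iff_left₀ (norm_nonneg _) (norm_nonneg _) two_ne_zero

/-- The inner product equals `⟪T* v, u⟫`, a lower bound for `‖T* v‖`; no computation of the adjoint
is needed. -/
theorem not_isHyponormal_of_norm_lt {T : H →L[ℂ] H} {u v : H} (hu : ‖u‖ = 1)
    (h : ‖T v‖ < ‖⟪v, T u⟫_ℂ‖) : ¬ IsHyponormal T := by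
  intro hT
  have h1 := isHyponormal_iff.1 hT v
  rw [← ContinuousLinearMap.adjoint_inner_left] at h
  have h2 := norm_inner_le_norm (𝕜 := ℂ) (ContinuousLinearMap.adjoint T v) u
  rw [hu, mul_one] at h2
  exact absurd (h.trans_le (h2.trans h1)) (lt_irrefl _)

/-- An operator that maps a Hilbert basis to multiples of a permuted part of it is hyponormal if
the weights increase along the orbits. -/
theorem isHyponormal_of_weights {ι : Type*} (b : HilbertBasis ι ℂ H) {T : H →L[ℂ] H} {w : ι → ℝ}
    {σ : ι → ι} (hσ : Function.Injective σ) (hT : ∀ i, T (b i) = (w i : ℂ) • b (σ i))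
    (hw0 : ∀ i, 0 ≤ w i) (hw : ∀ i, w i ≤ w (σ i)) : IsHyponormal T := by
  classical
  have hb := orthonormal_iff_ite.1 b.orthonormal
  have hadj : ∀ i, ContinuousLinearMap.adjoint T (b (σ i)) = (w i : ℂ) • b i := by
    intro i
    refine b.repr.injective (lp.ext (funext fun n => ?_))
    rw [HilbertBasis.repr_apply_apply, HilbertBasis.repr_apply_apply,
      ContinuousLinearMap.adjoint_inner_right, hT, inner_smul_left, inner_smul_right, hb, hb]
    by_cases h : n = i
    · subst h; simp
    · simp [h, hσ.ne h]
  rw [isHyponormal_iff]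
  intro x
  refine le_of_sq_le_sq ?_ (norm_nonneg _)
  have h1 := hasSum_norm_sq_inner b (ContinuousLinearMap.adjoint T x)
  have h2 := hasSum_norm_sq_inner b (T x)
  have e1 : ∀ i, ‖⟪b i, ContinuousLinearMap.adjoint T x⟫_ℂ‖ ^ 2 =
      w i ^ 2 * ‖⟪b (σ i), x⟫_ℂ‖ ^ 2 := by
    intro i
    rw [ContinuousLinearMap.adjoint_inner_right, hT, inner_smul_left, norm_mul, mul_pow]
    simp
  have e2 : ∀ i, ‖⟪b (σ i), T x⟫_ℂ‖ ^ 2 = w i ^ 2 * ‖⟪b i, x⟫_ℂ‖ ^ 2 := by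
    intro i
    rw [← ContinuousLinearMap.adjoint_inner_left, hadj, inner_smul_left, norm_mul, mul_pow]
    simp
  have s2 : Summable fun i => w i ^ 2 * ‖⟪b i, x⟫_ℂ‖ ^ 2 :=
    (h2.summable.comp_injective hσ).congr fun i => e2 i
  rw [← h1.tsum_eq, ← h2.tsum_eq]
  -- In coordinates, `‖T* x‖² = ∑ w_i² |x_{σ i}|² ≤ ∑ w_{σ i}² |x_{σ i}|² ≤ ∑ w_i² |x_i|² ≤ ‖T x‖²`.
  -- Injectivity of `σ` allows the two comparisons with full sums.
  calc ∑' i, ‖⟪b i, ContinuousLinearMap.adjoint T x⟫_ℂ‖ ^ 2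
      ≤ ∑' i, w (σ i) ^ 2 * ‖⟪b (σ i), x⟫_ℂ‖ ^ 2 := by
        refine h1.summable.tsum_le_tsum (fun i => ?_) (s2.comp_injective hσ)
        rw [e1]
        have := hw0 i
        gcongr
        exact hw i
    _ ≤ ∑' i, w i ^ 2 * ‖⟪b i, x⟫_ℂ‖ ^ 2 :=
        tsum_comp_le_tsum_of_inj s2 (fun i => by positivity) hσ
    _ = ∑' i, ‖⟪b (σ i), T x⟫_ℂ‖ ^ 2 := by simp only [e2]
    _ ≤ ∑' i, ‖⟪b i, T x⟫_ℂ‖ ^ 2 :=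
        tsum_comp_le_tsum_of_inj h2.summable (fun i => by positivity) hσ

end Hyponormality

/-! ### Monotonicity of the weights. -/

section Weights

theorem hWeight_pos (s δ m : ℕ) : 0 < hWeight s δ m := by
  unfold hWeight
  split_ifs with h
  · have : (m : ℝ) < δ := by exact_mod_cast h
    have h1 : (0 : ℝ) < δ - m + 1 := by linarith
    positivity
  · have : (δ : ℝ) ≤ m := by exact_mod_cast not_lt.1 h
    have h1 : (0 : ℝ) < m - δ + 1 := by linarith
    positivity

/-- The square is `(m+1)/(m+s+1) · (m-δ+1)/(m+s+1)`: the first quotient is nondecreasing in `m`, and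
the second strictly increasing because `s + δ > 0`. -/
theorem hWeight_lt {s δ m n : ℕ} (hδ : 0 < δ) (hm : δ ≤ m) (hmn : m < n) :
    hWeight s δ m < hWeight s δ n := by
  have hδ' : (0 : ℝ) < δ := by exact_mod_cast hδ
  have hm' : (δ : ℝ) ≤ m := by exact_mod_cast hm
  have hmn' : (m : ℝ) < n := by exact_mod_cast hmn
  have hs : (0 : ℝ) ≤ s := s.cast_nonneg
  rw [hWeight, hWeight, if_neg (by omega), if_neg (by omega),
    ← Real.sqrt_mul (by positivity), ← Real.sqrt_mul (by positivity),
    div_lt_div_iff₀ (by positivity) (by positivity)]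
  refine lt_of_pow_lt_pow_left₀ 2 (by positivity) ?_
  rw [mul_pow, mul_pow, Real.sq_sqrt (mul_nonneg (by positivity) (by linarith)),
    Real.sq_sqrt (mul_nonneg (by positivity) (by linarith))]
  have h1 : (m + 1) * (n + s + 1) ≤ (n + 1) * (m + s + 1 : ℝ) := by nlinarith
  have h2 : (m - δ + 1) * (n + s + 1) < (n - δ + 1) * (m + s + 1 : ℝ) := by nlinarith
  calc ((m : ℝ) + 1) * (m - δ + 1) * (n + s + 1) ^ 2
      = ((m + 1) * (n + s + 1)) * ((m - δ + 1) * (n + s + 1)) := by ring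
    _ < ((n + 1) * (m + s + 1)) * ((n - δ + 1) * (m + s + 1)) := by
        refine mul_lt_mul' h1 h2 (mul_nonneg (by linarith) (by positivity)) (by positivity)
    _ = _ := by ring

theorem hWeight_zero {s δ : ℕ} (hδ : 0 < δ) : hWeight s δ 0 = hWeight s δ δ := by
  rw [hWeight, hWeight, if_pos hδ, if_neg (lt_irrefl _)]
  simp [add_comm]

/-- For `δ = 1` the index map swaps `0` and `1`, whose weights agree, fixes `2`, and moves every
larger index up. -/
theorem hWeight_le_hIndex (s m : ℕ) : hWeight s 1 m ≤ hWeight s 1 (hIndex 1 m) := by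
  rcases m with _ | _ | m
  · exact (hWeight_zero one_pos).le
  · exact (hWeight_zero one_pos).ge
  · rw [hIndex, if_neg (by omega)]
    rcases Nat.eq_zero_or_pos m with rfl | hm
    · exact le_rfl
    · exact (hWeight_lt one_pos (by omega) (by omega)).le

theorem hWeight_founder (s δ : ℕ) (j : founders δ) (n : ℕ) :
    hWeight s δ (2 ^ n * ((j : ℕ) - 2 * δ) + 2 * δ) = weight₁ s δ j n * weight₂ s δ j n := by
  have hj : 2 * δ + 1 ≤ (j : ℕ) := j.2.1
  obtain ⟨l, hl⟩ := Nat.exists_eq_add_of_le hj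
  have hl0 : ((j : ℕ) : ℝ) - 2 * δ = l + 1 := by rw [hl]; push_cast; ring
  have hl1 : (j : ℕ) - 2 * δ = l + 1 := by omega
  have key : ∀ N D : ℝ, 0 ≤ N → 0 ≤ D → grwsWeight 2 (N / (l + 1)) (D / (l + 1)) n =
      √(2 ^ n * (l + 1) + N) / √(2 ^ n * (l + 1) + D) := by
    intro N D hN hD
    rw [grwsWeight, ← Real.sqrt_div (by positivity)]
    congr 1
    rw [div_eq_div_iff (by positivity) (by positivity)]
    field_simp
  rw [weight₁, weight₂, hl0, key _ _ (by positivity) (by positivity),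
    key _ _ (by positivity) (by positivity), div_mul_div_comm, Real.mul_self_sqrt (by positivity),
    hl1, hWeight, if_neg (by omega)]
  push_cast
  congr 1
  · congr 2 <;> ring
  · ring

end Weights

/-! ### Orbits of the index map and the model space. -/

section Decomposition

/-- The index set of the canonical basis of `ℂ^{2δ} ⊕ ℂ ⊕ ⨁ j, ℓ²`. -/
abbrev DecompIndex (δ : ℕ) : Type := Fin (2 * δ) ⊕ Unit ⊕ (founders δ × ℕ)

/-- The space `ℂ^{2δ} ⊕ ℂ ⊕ ⨁ j, ℓ²`. -/
abbrev DecompSpace (δ : ℕ) : Type :=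
  WithLp 2 (EuclideanSpace ℂ (Fin (2 * δ)) ×
    WithLp 2 (ℂ × lp (fun _ : founders δ => lp (fun _ : ℕ => ℂ) 2) 2))

/-- The position of a canonical basis vector in the basis of the Bergman space. -/
def decompPos (δ : ℕ) : DecompIndex δ → ℕ
  | .inl m => m
  | .inr (.inl _) => 2 * δ
  | .inr (.inr (j, n)) => 2 ^ n * ((j : ℕ) - 2 * δ) + 2 * δ

/-- The canonical basis of `ℂ^{2δ} ⊕ ℂ ⊕ ⨁ j, ℓ²`. -/
noncomputable def decompVec (δ : ℕ) : DecompIndex δ → DecompSpace δ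
  | .inl m => WithLp.toLp 2 (EuclideanSpace.single m (1 : ℂ), WithLp.toLp 2 (0, 0))
  | .inr (.inl _) => WithLp.toLp 2 (0, WithLp.toLp 2 (1, 0))
  | .inr (.inr (j, n)) =>
      WithLp.toLp 2 (0, WithLp.toLp 2 (0, lp.single 2 j (lp.single 2 n (1 : ℂ))))

theorem odd_of_mem_founders {δ j : ℕ} (hj : j ∈ founders δ) : Odd (j - 2 * δ) := by
  have h1 := hj.1
  by_contra h
  rw [Nat.not_odd_iff_even] at h
  obtain ⟨c, hc⟩ := h
  -- If `j - 2δ = 2c`, then `j` is the image of `2δ + c`.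
  exact hj.2 (δ + (c + δ)) (by omega) (by omega)

theorem two_pow_mul_odd_inj {a b l m : ℕ} (hl : Odd l) (hm : Odd m)
    (h : 2 ^ a * l = 2 ^ b * m) : a = b ∧ l = m := by
  have key : ∀ {a b l m : ℕ}, Odd l → Odd m → 2 ^ a * l = 2 ^ b * m → a ≤ b → a = b ∧ l = m := by
    intro a b l m hl hm h hab
    obtain ⟨c, rfl⟩ := Nat.exists_eq_add_of_le hab
    rw [pow_add, mul_assoc] at h
    have h1 := Nat.eq_of_mul_eq_mul_left (by positivity) h
    rcases Nat.eq_zero_or_pos c with rfl | hc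
    · exact ⟨rfl, by simpa using h1⟩
    · rw [h1] at hl
      have : Even (2 ^ c * m) := ((even_two.pow_of_ne_zero hc.ne')).mul_right m
      exact absurd hl (Nat.not_odd_iff_even.2 this)
  rcases le_total a b with hab | hab
  · exact key hl hm h hab
  · obtain ⟨h1, h2⟩ := key hm hl h.symm hab
    exact ⟨h1.symm, h2.symm⟩

/-- Above `2δ` this is the unique factorization of `m - 2δ` into a power of two and an odd number,
the odd parts being exactly `j - 2δ` for founders `j`. -/
theorem decompPos_bijective (δ : ℕ) : Function.Bijective (decompPos δ) := by
  have hpos : ∀ (j : founders δ) (n : ℕ), 0 < 2 ^ n * ((j : ℕ) - 2 * δ) := by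
    intro j n
    have := j.2.1
    exact Nat.mul_pos (by positivity) (by omega)
  constructor
  · rintro (m | m | ⟨j, n⟩) (m' | m' | ⟨j', n'⟩) h <;> simp only [decompPos] at h
    · exact congrArg _ (Fin.ext h)
    · have := m.2; omega
    · have := m.2; omega
    · have := m'.2; omega
    · rfl
    · have := hpos j' n'; omega
    · have := m'.2; omega
    · have := hpos j n; omega
    · obtain ⟨h1, h2⟩ := two_pow_mul_odd_inj (odd_of_mem_founders j.2)
        (odd_of_mem_founders j'.2) (Nat.add_right_cancel h)
      have h3 := j.2.1
      have h4 := j'.2.1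
      obtain rfl : j = j' := Subtype.ext (by omega)
      rw [h1]
  · intro m
    rcases lt_trichotomy m (2 * δ) with h | h | h
    · exact ⟨.inl ⟨m, h⟩, rfl⟩
    · exact ⟨.inr (.inl ()), h.symm⟩
    · obtain ⟨a, l, hl, hal⟩ := Nat.exists_eq_two_pow_mul_odd (n := m - 2 * δ) (by omega)
      have hl0 := hl.pos
      have hmem : l + 2 * δ ∈ founders δ := by
        refine ⟨by omega, fun m' hm' he => ?_⟩
        obtain ⟨c, hc⟩ := hl
        omega
      refine ⟨.inr (.inr (⟨l + 2 * δ, hmem⟩, a)), ?_⟩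
      simp only [decompPos, Nat.add_sub_cancel]
      omega

theorem orthonormal_decompVec (δ : ℕ) : Orthonormal ℂ (decompVec δ) := by
  rw [orthonormal_iff_ite]
  rintro (m | m | ⟨j, n⟩) (m' | m' | ⟨j', n'⟩)
  · simp [decompVec, WithLp.prod_inner_apply, EuclideanSpace.inner_single_left]
  · simp [decompVec, WithLp.prod_inner_apply]
  · simp [decompVec, WithLp.prod_inner_apply]
  · simp [decompVec, WithLp.prod_inner_apply]
  · simp [decompVec]
  · simp [decompVec, WithLp.prod_inner_apply]
  · simp [decompVec, WithLp.prod_inner_apply]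
  · simp [decompVec, WithLp.prod_inner_apply]
  · simp only [decompVec, WithLp.prod_inner_apply, inner_zero_left, zero_add,
      lp.inner_single_left, lp.coeFn_single]
    by_cases hj : j = j'
    · subst hj
      by_cases hn : n = n'
      · subst hn; simp
      · simp [hn]
    · simp [hj]

theorem decompVec_orthogonal_eq_bot (δ : ℕ) :
    (Submodule.span ℂ (Set.range (decompVec δ)))ᗮ = ⊥ := by
  rw [Submodule.eq_bot_iff]
  intro y hy
  have h : ∀ i, ⟪decompVec δ i, y⟫_ℂ = 0 := fun i =>
    (Submodule.mem_orthogonal _ _).1 hy _ (Submodule.subset_span ⟨i, rfl⟩)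
  have h1 : y.fst = 0 := by
    ext m
    have := h (.inl m)
    simpa [decompVec, WithLp.prod_inner_apply, EuclideanSpace.inner_single_left] using this
  have h2 : y.snd.fst = 0 := by
    have := h (.inr (.inl ()))
    simpa [decompVec, WithLp.prod_inner_apply] using this
  have h3 : y.snd.snd = 0 := by
    refine lp.ext (funext fun j => lp.ext (funext fun n => ?_))
    have := h (.inr (.inr (j, n)))
    simp only [decompVec, WithLp.prod_inner_apply, inner_zero_left, zero_add,
      lp.inner_single_left] at this
    simpa using this
  have h4 : y.snd = 0 := WithLp.ofLp_injective 2 (Prod.ext h2 h3)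
  exact WithLp.ofLp_injective 2 (Prod.ext h1 h4)

end Decomposition

/-! ### The orthogonal decomposition and its finite-dimensional summand. -/

section Main

theorem exists_linearIsometryEquiv (δ : ℕ) : ∃ U : bergman ≃ₗᵢ[ℂ] DecompSpace δ,
    ∀ i, U (basisVec (decompPos δ i)) = decompVec δ i := by
  classical
  have hv : Orthonormal ℂ (basisVec ∘ decompPos δ) :=
    orthonormal_basisVec.comp _ (decompPos_bijective δ).1
  have hv' : (Submodule.span ℂ (Set.range (basisVec ∘ decompPos δ)))ᗮ = ⊥ := by
    rw [(decompPos_bijective δ).2.range_comp, basisVec_orthogonal_eq_bot]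
  set b := HilbertBasis.mkOfOrthogonalEqBot hv hv' with hb
  set c := HilbertBasis.mkOfOrthogonalEqBot (orthonormal_decompVec δ)
    (decompVec_orthogonal_eq_bot δ) with hc
  refine ⟨b.repr.trans c.repr.symm, fun i => ?_⟩
  have h1 : b i = basisVec (decompPos δ i) := by
    rw [hb, HilbertBasis.coe_mkOfOrthogonalEqBot]; rfl
  rw [← h1, LinearIsometryEquiv.trans_apply, HilbertBasis.repr_self,
    HilbertBasis.repr_symm_single, hc, HilbertBasis.coe_mkOfOrthogonalEqBot]

theorem clm_ext_basisVec {δ : ℕ} {E : Type*} [NormedAddCommGroup E] [NormedSpace ℂ E]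
    {S T : bergman →L[ℂ] E}
    (h : ∀ i, S (basisVec (decompPos δ i)) = T (basisVec (decompPos δ i))) (f : bergman) :
    S f = T f := by
  have hd : Dense (Submodule.span ℂ (Set.range basisVec) : Set bergman) := by
    rw [Submodule.dense_iff_topologicalClosure_eq_top,
      Submodule.topologicalClosure_eq_top_iff, basisVec_orthogonal_eq_bot]
  have : S = T := by
    refine ContinuousLinearMap.ext_on hd ?_
    rintro _ ⟨n, rfl⟩
    obtain ⟨i, rfl⟩ := (decompPos_bijective δ).2 n
    exact h i
  rw [this]

theorem hIndex_lt {δ m : ℕ} (h : m < 2 * δ) : hIndex δ m < 2 * δ := by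
  unfold hIndex
  split_ifs <;> omega

theorem hIndex_two_mul (δ : ℕ) : hIndex δ (2 * δ) = 2 * δ := by
  unfold hIndex
  split_ifs <;> omega

theorem hIndex_founder (δ l n : ℕ) : hIndex δ (2 ^ n * l + 2 * δ) = 2 ^ (n + 1) * l + 2 * δ := by
  unfold hIndex
  rw [if_neg (by omega), pow_succ, Nat.mul_right_comm]
  omega

/-- The finite-dimensional summand of `B*` on `ℂ^{2δ}`. -/
theorem finite_part {s δ : ℕ} {M : EuclideanSpace ℂ (Fin (2 * δ)) →L[ℂ]
      EuclideanSpace ℂ (Fin (2 * δ))}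
    (hM : ∀ m : Fin (2 * δ), M (EuclideanSpace.single m 1) =
      (hWeight s δ m : ℂ) • EuclideanSpace.single ⟨hIndex δ m, hIndex_lt m.2⟩ 1) :
    (δ = 1 → IsStarNormal M) ∧ (1 < δ → ¬ IsHyponormal M ∧ ¬ IsCohyponormal M) := by
  have hinner : ∀ m n : Fin (2 * δ), ⟪EuclideanSpace.single m (1 : ℂ),
      M (EuclideanSpace.single n 1)⟫_ℂ = if (m : ℕ) = hIndex δ n then (hWeight s δ n : ℂ) else 0 := by
    intro m n
    rw [hM, inner_smul_right, EuclideanSpace.inner_single_left]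
    by_cases h : (m : ℕ) = hIndex δ n
    · have : m = ⟨hIndex δ n, hIndex_lt n.2⟩ := Fin.ext h
      simp [this]
    · have : m ≠ ⟨hIndex δ n, hIndex_lt n.2⟩ := fun h' => h (congrArg Fin.val h')
      simp [h, this]
  refine ⟨?_, fun hδ => ⟨?_, ?_⟩⟩
  · rintro rfl
    -- `M` swaps the two basis vectors, with the same real weight both ways.
    have hself : ContinuousLinearMap.adjoint M = M := by
      refine ContinuousLinearMap.coe_injective
        ((EuclideanSpace.basisFun (Fin 2) ℂ).toBasis.ext fun n => ?_)
      ext m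
      simp only [OrthonormalBasis.coe_toBasis, EuclideanSpace.basisFun_apply]
      have h1 : ⟪EuclideanSpace.single m (1 : ℂ), ContinuousLinearMap.adjoint M
          (EuclideanSpace.single n 1)⟫_ℂ =
          ⟪EuclideanSpace.single m (1 : ℂ), M (EuclideanSpace.single n 1)⟫_ℂ := by
        have h0 := hWeight_zero (s := s) (δ := 1) (by omega)
        rw [ContinuousLinearMap.adjoint_inner_right, ← inner_conj_symm, hinner, hinner]
        fin_cases m <;> fin_cases n <;> simp [hIndex, h0]
      simpa [EuclideanSpace.inner_single_left] using h1
    exact ⟨by rw [ContinuousLinearMap.star_eq_adjoint, hself]⟩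
  -- Here `M` sends `e_{2δ-1}` to a multiple of `e_{2δ-2}`, and the next weight on the orbit is
  -- smaller; `δ > 1` ensures `2δ - 2 ≥ δ`.
  · refine not_isHyponormal_of_norm_lt
      (u := EuclideanSpace.single ⟨2 * δ - 1, by omega⟩ 1)
      (v := EuclideanSpace.single ⟨2 * δ - 2, by omega⟩ 1) (by simp) ?_
    rw [hinner, hM, if_pos (by simp only [hIndex]; rw [if_neg (by omega)]; omega), norm_smul]
    simp only [Complex.norm_real, PiLp.norm_single, norm_one, mul_one]
    rw [Real.norm_of_nonneg (hWeight_pos _ _ _).le, Real.norm_of_nonneg (hWeight_pos _ _ _).le]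
    exact hWeight_lt (by omega) (by omega) (by omega)
  -- The only preimage of `2δ - 1` is `0`, so `M*` has norm `w_0 = w_δ` on `e_{2δ-1}`, while `M` has
  -- norm `w_{2δ-1} > w_δ` there.
  · have hadj : ContinuousLinearMap.adjoint M
        (EuclideanSpace.single ⟨2 * δ - 1, by omega⟩ 1) =
        (hWeight s δ 0 : ℂ) • EuclideanSpace.single ⟨0, by omega⟩ 1 := by
      ext n
      have h1 : ⟪EuclideanSpace.single n (1 : ℂ), ContinuousLinearMap.adjoint M
          (EuclideanSpace.single ⟨2 * δ - 1, by omega⟩ 1)⟫_ℂ =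
          if (2 * δ - 1 : ℕ) = hIndex δ n then (hWeight s δ n : ℂ) else 0 := by
        rw [ContinuousLinearMap.adjoint_inner_right, ← inner_conj_symm, hinner]
        split_ifs <;> simp
      rw [EuclideanSpace.inner_single_left, map_one, one_mul] at h1
      rw [h1]
      by_cases hn : n = ⟨0, by omega⟩
      · subst hn
        rw [if_pos (by simp only [hIndex]; rw [if_pos (by omega)]; omega)]
        simp
      · have hn' : (n : ℕ) ≠ 0 := fun h => hn (Fin.ext h)
        rw [if_neg (by simp only [hIndex]; split_ifs <;> omega)]
        simp [hn]
    refine not_isHyponormal_of_norm_lt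
      (u := EuclideanSpace.single ⟨2 * δ - 2, by omega⟩ 1)
      (v := EuclideanSpace.single ⟨2 * δ - 1, by omega⟩ 1) (by simp) ?_
    rw [ContinuousLinearMap.adjoint_inner_right, ← inner_conj_symm, RCLike.norm_conj, hinner, hadj,
      if_pos (by simp only [hIndex]; rw [if_neg (by omega)]; omega), norm_smul]
    simp only [Complex.norm_real, PiLp.norm_single, norm_one, mul_one]
    rw [Real.norm_of_nonneg (hWeight_pos _ _ _).le, Real.norm_of_nonneg (hWeight_pos _ _ _).le,
      hWeight_zero (by omega)]
    exact hWeight_lt (by omega) le_rfl (by omega)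

/-- The component of `DecompSpace δ` in `ℂ^{2δ}`. -/
noncomputable def coordFin (δ : ℕ) : DecompSpace δ →L[ℂ] EuclideanSpace ℂ (Fin (2 * δ)) :=
  WithLp.fstL 2 ℂ _ _

/-- The component of `DecompSpace δ` in `ℂ`. -/
noncomputable def coordOne (δ : ℕ) : DecompSpace δ →L[ℂ] ℂ :=
  (WithLp.fstL 2 ℂ ℂ (lp (fun _ : founders δ => lp (fun _ : ℕ => ℂ) 2) 2)).comp
    (WithLp.sndL 2 ℂ _ _)

/-- The component of `DecompSpace δ` in the sum of the sequence spaces. -/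
noncomputable def coordSeq (δ : ℕ) :
    DecompSpace δ →L[ℂ] lp (fun _ : founders δ => lp (fun _ : ℕ => ℂ) 2) 2 :=
  (WithLp.sndL 2 ℂ ℂ (lp (fun _ : founders δ => lp (fun _ : ℕ => ℂ) 2) 2)).comp
    (WithLp.sndL 2 ℂ _ _)

/-- The component of `DecompSpace δ` in the sequence space with index `j`. -/
noncomputable def coordShift (δ : ℕ) (j : founders δ) :
    DecompSpace δ →L[ℂ] lp (fun _ : ℕ => ℂ) 2 :=
  (lp.evalCLM ℂ (fun _ : founders δ => lp (fun _ : ℕ => ℂ) 2) 2 j).comp (coordSeq δ)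

theorem coordSeq_apply {δ : ℕ} (x : DecompSpace δ) : coordSeq δ x = x.snd.snd := rfl

theorem coordShift_apply {δ : ℕ} (j : founders δ) (x : DecompSpace δ) :
    coordShift δ j x = x.snd.snd j := by
  rw [← coordSeq_apply]
  rfl

theorem coordShift_founder {δ : ℕ} (j j' : founders δ) (n : ℕ) :
    coordShift δ j (decompVec δ (.inr (.inr (j', n)))) = if j = j' then lp.single 2 n 1 else 0 := by
  rw [coordShift_apply]
  split_ifs with h
  · subst h
    simp [decompVec]
  · simp [decompVec, h]

theorem coordShift_inl {δ : ℕ} (j : founders δ) (m : Fin (2 * δ)) :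
    coordShift δ j (decompVec δ (.inl m)) = 0 := by
  rw [coordShift_apply]
  simp [decompVec]

theorem coordShift_inr_inl {δ : ℕ} (j : founders δ) :
    coordShift δ j (decompVec δ (.inr (.inl ()))) = 0 := by
  rw [coordShift_apply]
  simp [decompVec]

/-- Each component identity is between continuous linear maps, so it is enough to check it on the
basis, orbit by orbit. The action of `M` on basis vectors is returned for the later study of its
normality. -/
theorem decomposition {s δ : ℕ} {T : bergman →L[ℂ] bergman}
    (hT : ∀ m, T (basisVec m) = (hWeight s δ m : ℂ) • basisVec (hIndex δ m)) :
    ∃ (M : EuclideanSpace ℂ (Fin (2 * δ)) →L[ℂ] EuclideanSpace ℂ (Fin (2 * δ)))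
      (D₁ : ℂ →L[ℂ] ℂ) (U : bergman ≃ₗᵢ[ℂ] DecompSpace δ),
      (∀ i, U (basisVec (decompPos δ i)) = decompVec δ i) ∧
      (∀ f : bergman,
        (U (T f)).fst = M (U f).fst ∧
        (U (T f)).snd.fst = D₁ (U f).snd.fst ∧
        ∀ j : founders δ, (U (T f)).snd.snd j = schurShift s δ j ((U f).snd.snd j)) ∧
      (∀ m : Fin (2 * δ), M (EuclideanSpace.single m 1) =
        (hWeight s δ m : ℂ) • EuclideanSpace.single ⟨hIndex δ m, hIndex_lt m.2⟩ 1) := by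
  obtain ⟨U, hU⟩ := exists_linearIsometryEquiv δ
  have hU1 : ∀ m : Fin (2 * δ), U (T (basisVec (decompPos δ (.inl m)))) =
      (hWeight s δ m : ℂ) • decompVec δ (.inl ⟨hIndex δ m, hIndex_lt m.2⟩) := by
    intro m
    rw [hT, map_smul, ← hU]
    rfl
  have hU2 : U (T (basisVec (decompPos δ (.inr (.inl ()))))) =
      (hWeight s δ (2 * δ) : ℂ) • decompVec δ (.inr (.inl ())) := by
    rw [hT, map_smul, ← hU]
    simp only [decompPos, hIndex_two_mul]
  have hU3 : ∀ (j : founders δ) (n : ℕ), U (T (basisVec (decompPos δ (.inr (.inr (j, n)))))) =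
      ((weight₁ s δ j n * weight₂ s δ j n : ℝ) : ℂ) • decompVec δ (.inr (.inr (j, n + 1))) := by
    intro j n
    rw [hT, map_smul, ← hU]
    simp only [decompPos, hIndex_founder, hWeight_founder]
  have hF0 : ∀ p, coordFin δ (decompVec δ (.inr p)) = 0 := by
    rintro (_ | _) <;> rfl
  have hF1 : ∀ m, coordFin δ (decompVec δ (.inl m)) = EuclideanSpace.single m 1 := fun _ => rfl
  set V : bergman →L[ℂ] DecompSpace δ := U.toContinuousLinearEquiv.toContinuousLinearMap
  set M : EuclideanSpace ℂ (Fin (2 * δ)) →L[ℂ] EuclideanSpace ℂ (Fin (2 * δ)) :=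
    LinearMap.toContinuousLinearMap ((EuclideanSpace.basisFun (Fin (2 * δ)) ℂ).toBasis.constr ℂ
      fun m => (hWeight s δ m : ℂ) • EuclideanSpace.single ⟨hIndex δ m, hIndex_lt m.2⟩ (1 : ℂ))
  set D : ℂ →L[ℂ] ℂ := (hWeight s δ (2 * δ) : ℂ) • ContinuousLinearMap.id ℂ ℂ
  have hM : ∀ m : Fin (2 * δ), M (EuclideanSpace.single m 1) =
      (hWeight s δ m : ℂ) • EuclideanSpace.single ⟨hIndex δ m, hIndex_lt m.2⟩ 1 := by
    intro m
    have h := (EuclideanSpace.basisFun (Fin (2 * δ)) ℂ).toBasis.constr_basis ℂ (fun m =>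
      (hWeight s δ m : ℂ) • EuclideanSpace.single (⟨hIndex δ m, hIndex_lt m.2⟩ : Fin (2 * δ))
        (1 : ℂ)) m
    rwa [OrthonormalBasis.coe_toBasis, EuclideanSpace.basisFun_apply] at h
  refine ⟨M, D, U, hU, fun f => ⟨?_, ?_, fun j => ?_⟩, hM⟩
  · refine clm_ext_basisVec (δ := δ) (S := ((coordFin δ).comp V).comp T)
      (T := M.comp ((coordFin δ).comp V)) ?_ f
    intro i
    change coordFin δ (U (T _)) = M (coordFin δ (U _))
    obtain m | m | ⟨j, n⟩ := i
    · rw [hU1, hU, map_smul, hF1, hF1, hM]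
    · rw [hU2, hU, map_smul, hF0, smul_zero, map_zero]
    · rw [hU3, hU, map_smul, hF0, hF0, smul_zero, map_zero]
  · refine clm_ext_basisVec (δ := δ) (S := ((coordOne δ).comp V).comp T)
      (T := D.comp ((coordOne δ).comp V)) ?_ f
    intro i
    change coordOne δ (U (T _)) = D (coordOne δ (U _))
    obtain m | m | ⟨j, n⟩ := i
    · have h0 : ∀ m, coordOne δ (decompVec δ (.inl m)) = 0 := fun _ => rfl
      rw [hU1, hU, map_smul, h0, h0, smul_zero, map_zero]
    · rw [hU2, hU, map_smul]
      rfl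
    · have h0 : ∀ p, coordOne δ (decompVec δ (.inr (.inr p))) = 0 := fun _ => rfl
      rw [hU3, hU, map_smul, h0, h0, smul_zero, map_zero]
  · rw [← coordShift_apply, ← coordShift_apply]
    refine clm_ext_basisVec (δ := δ) (S := ((coordShift δ j).comp V).comp T)
      (T := (schurShift s δ j).comp ((coordShift δ j).comp V)) ?_ f
    intro i
    change coordShift δ j (U (T _)) = schurShift s δ j (coordShift δ j (U _))
    obtain m | m | ⟨j', n⟩ := i
    · rw [hU1, hU, map_smul, coordShift_inl, coordShift_inl, smul_zero, map_zero]
    · rw [hU2, hU, map_smul, coordShift_inr_inl, smul_zero, map_zero]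
    · rw [hU3, hU, map_smul, coordShift_founder, coordShift_founder]
      split_ifs with h
      · subst h
        rw [schurShift, weightedShift_single]
      · rw [smul_zero, map_zero]

end Main

end HToeplitz

/-! ### Assembly of the theorem. -/

theorem mainTheorem4 (s t δ : ℕ) (hst : s < t) (hδ : δ = t - s)
    (B Bstar : HToeplitz.bergman →L[ℂ] HToeplitz.bergman)
    (hB : B = HToeplitz.hToeplitz (HToeplitz.monomial ∞ t s))
    (hBstar : Bstar = ContinuousLinearMap.adjoint B) :
    (∃ (M : EuclideanSpace ℂ (Fin (2 * δ)) →L[ℂ] EuclideanSpace ℂ (Fin (2 * δ)))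
      (D₁ : ℂ →L[ℂ] ℂ)
      (U : HToeplitz.bergman ≃ₗᵢ[ℂ]
        WithLp 2 (EuclideanSpace ℂ (Fin (2 * δ)) ×
          WithLp 2 (ℂ × lp (fun _ : HToeplitz.founders δ => lp (fun _ : ℕ => ℂ) 2) 2))),
      -- `U` carries the vectors `e_m` to the canonical basis vectors
      (∀ m : Fin (2 * δ), U (HToeplitz.basisVec m) =
        WithLp.toLp 2 (EuclideanSpace.single m (1 : ℂ), WithLp.toLp 2 (0, 0))) ∧
      U (HToeplitz.basisVec (2 * δ)) = WithLp.toLp 2 (0, WithLp.toLp 2 (1, 0)) ∧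
      (∀ (j : HToeplitz.founders δ) (n : ℕ),
        U (HToeplitz.basisVec (2 ^ n * ((j : ℕ) - 2 * δ) + 2 * δ)) =
          WithLp.toLp 2 (0, WithLp.toLp 2 (0, lp.single 2 j (lp.single 2 n (1 : ℂ))))) ∧
      -- `U B* U⁻¹ = M ⊕ D₁ ⊕ (⨁ j, W₁(s, δ, j) ∘ W₂(s, δ, j))`
      (∀ f : HToeplitz.bergman,
        (U (Bstar f)).fst = M (U f).fst ∧
        (U (Bstar f)).snd.fst = D₁ (U f).snd.fst ∧
        ∀ j : HToeplitz.founders δ,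
          (U (Bstar f)).snd.snd j = HToeplitz.schurShift s δ j ((U f).snd.snd j)) ∧
      IsStarNormal D₁ ∧
      (δ = 1 → IsStarNormal M) ∧
      (1 < δ → ¬ HToeplitz.IsHyponormal M ∧ ¬ HToeplitz.IsCohyponormal M)) ∧
    (∀ j : HToeplitz.founders δ, HToeplitz.IsKHyponormal 1 (HToeplitz.schurShift s δ j)) ∧
    (∀ k : ℕ, 1 ≤ k →
      min ((2 : ℝ) ^ ((k : ℤ) - 1) * (2 * δ + 1))
        ((2 : ℝ) ^ ((k : ℤ) - 2) * (2 * δ - 1) + (2 : ℝ) ^ ((k : ℤ) - 1) - 1) ≤ (s : ℝ) →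
      ∀ j : HToeplitz.founders δ, HToeplitz.IsKHyponormal k (HToeplitz.schurShift s δ j)) ∧
    (δ = 1 → HToeplitz.IsHyponormal Bstar ∧ ¬ HToeplitz.IsHyponormal B) ∧
    (1 < δ → ¬ HToeplitz.IsHyponormal Bstar ∧ ¬ HToeplitz.IsHyponormal B) ∧
    ‖Bstar‖ ≤ 1 ∧ ‖B‖ ≤ 1 := by
  have hδ0 : 0 < δ := by omega
  obtain rfl : t = s + δ := by omega
  have hT : ∀ m, Bstar (HToeplitz.basisVec m) =
      (HToeplitz.hWeight s δ m : ℂ) • HToeplitz.basisVec (HToeplitz.hIndex δ m) := by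
    intro m
    rw [hBstar, hB, HToeplitz.adjoint_hToeplitz_basisVec]
  have hone : ∀ m, ‖HToeplitz.basisVec m‖ = 1 := HToeplitz.orthonormal_basisVec.1
  have hB1 : ‖B‖ ≤ 1 := hB ▸ HToeplitz.norm_hToeplitz_monomial_le _ _
  -- The index `2δ + 1` is not a value of `σ`, whose odd values are below `2δ`. So `B` kills
  -- `e_{2δ+1}`, while `B* e_{2δ+1}` is nonzero.
  have hnB : ¬ HToeplitz.IsHyponormal B := by
    refine HToeplitz.not_isHyponormal_of_norm_lt
      (v := HToeplitz.basisVec (2 * δ + 1)) (hone (HToeplitz.hIndex δ (2 * δ + 1))) ?_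
    have h1 : B (HToeplitz.basisVec (2 * δ + 1)) = 0 := by
      refine HToeplitz.ext_inner_basisVec fun n => ?_
      rw [hB, HToeplitz.inner_basisVec_hToeplitz, if_neg
        (by unfold HToeplitz.hIndex; split_ifs <;> omega), inner_zero_right]
    rw [h1, norm_zero, hB, HToeplitz.inner_basisVec_hToeplitz, if_pos rfl, Complex.norm_real,
      Real.norm_of_nonneg (HToeplitz.hWeight_pos _ _ _).le]
    exact HToeplitz.hWeight_pos _ _ _
  refine ⟨?_, ?_, ?_, ?_, ?_, ?_, hB1⟩
  · obtain ⟨M, D, U, hU, hdec, hM⟩ := HToeplitz.decomposition hT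
    obtain ⟨hM1, hM2⟩ := HToeplitz.finite_part hM
    refine ⟨M, D, U, fun m => hU (.inl m), hU (.inr (.inl ())), fun j n => hU (.inr (.inr (j, n))),
      hdec, ⟨?_⟩, hM1, hM2⟩
    refine ContinuousLinearMap.ext_ring ?_
    have h1 : ∀ (S : ℂ →L[ℂ] ℂ) (x : ℂ), S x = x * S 1 := fun S x => by
      rw [← smul_eq_mul, ← map_smul, smul_eq_mul, mul_one]
    change star D (D 1) = D (star D 1)
    rw [h1 (star D), h1 D (star D 1), mul_comm]
  · exact HToeplitz.isKHyponormal_schurShift hδ0 le_rfl (Or.inl rfl)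
  · exact fun k hk h => HToeplitz.isKHyponormal_schurShift hδ0 hk
      (Or.inr (HToeplitz.threshold_le hk h))
  · rintro rfl
    refine ⟨?_, hnB⟩
    refine HToeplitz.isHyponormal_of_weights HToeplitz.bergmanBasis
      (HToeplitz.hIndex_injective 1) (w := HToeplitz.hWeight s 1) (fun i => ?_)
      (fun i => (HToeplitz.hWeight_pos _ _ _).le) (HToeplitz.hWeight_le_hIndex s)
    rw [HToeplitz.bergmanBasis_apply, HToeplitz.bergmanBasis_apply, hT]
  · refine fun h1 => ⟨?_, hnB⟩
    -- The same pair of basis vectors as for `M`: the weight drops from `2δ - 1` to `2δ - 2`.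
    refine HToeplitz.not_isHyponormal_of_norm_lt (v := HToeplitz.basisVec (2 * δ - 2))
      (hone (2 * δ - 1)) ?_
    rw [hT, hT, norm_smul, hone, mul_one]
    have h2 : HToeplitz.hIndex δ (2 * δ - 1) = 2 * δ - 2 := by
      unfold HToeplitz.hIndex
      rw [if_neg (by omega)]
      omega
    have h3 := inner_smul_right (𝕜 := ℂ) (HToeplitz.basisVec (2 * δ - 2))
      (HToeplitz.basisVec (2 * δ - 2)) (HToeplitz.hWeight s δ (2 * δ - 1) : ℂ)
    rw [h2, h3, inner_self_eq_norm_sq_to_K, hone]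
    simp only [Complex.norm_real, RCLike.ofReal_one, one_pow, mul_one]
    rw [Real.norm_of_nonneg (HToeplitz.hWeight_pos _ _ _).le,
      Real.norm_of_nonneg (HToeplitz.hWeight_pos _ _ _).le]
    exact HToeplitz.hWeight_lt hδ0 (by omega) (by omega)
  · rw [hBstar, LinearIsometryEquiv.norm_map]
    exact hB1
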